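/- **Theorem (Convergence of pseudo-VNE to VWE).** *Notation.* Fix $T\in\mathbb N$, $M>0$, $B_{\mathbf f}>0$ and put $\mathcal M=[0,M+1]^T\subset\mathbb R^T$ (Euclidean norm). For a function $\varphi$ on $C\subset\mathbb R^T$, $\partial\varphi(x)=\{g:\varphi(z)\ge\varphi(x)+\langle g,z-x\rangle\ \forall z\in C\}$; $\partial_1$ is the subdifferential in the first variable. $d_H$ is the Hausdorff distance, $\mathrm{ri}$ the relative interior in the affine hull, and $\mathrm{rbd}\,C$ the boundary of $C$ in the linear span of $C$ (with $d(x,\emptyset)=+\infty$). *Nonatomic game $\mathcal G$.* Players $\theta\in\Theta=[0,1]$ (Lebesgue measure) have action sets $\mathcal X_\theta\subset\mathbb R^T_{+}$ and costs $f_\theta(x,Y)$, where $x$ is the own action and $Y$ the aggregate action. Assume: - each $\mathcal X_\theta$ is nonempty, convex, compact and contained in the closed ball of radius $M$ around $0$, and $\{(\theta,x):x\in\mathcal X_\theta\}$ is a Borel set; - there is a neighbourhood $\mathcal M'$ of $\mathcal M$ such that for every $Y\in\mathcal M$: $\theta\mapsto f_\theta(x,Y)$ is measurable for every $x\in\mathcal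 M'$; $f_\theta(\cdot,Y)$ is continuous and convex on $\mathcal M'$ for every $\theta$; and $\|g\|\le B_{\mathbf f}$ for all $g\in\partial_1f_\theta(x,Y)$, $x\in\mathcal M$, $\theta\in\Theta$. Moreover each $f_\theta$ is bounded on $\mathcal M^2$, and $f_\theta(x,\cdot)$ is continuous on $\mathcal M$ for every $x\in\mathcal M$. Let $\mathcal X=\{x\in L^2([0,1],\mathbb R^T):x_\theta\in\mathcal X_\theta\text{ a.e.}\}$, let $\overline{\mathcal X}=\{\int x:x\in\mathcal X\}$, and for $A\subset\mathbb R^T$ let $\mathcal X(A)=\{x\in\mathcal X:\int x\in A\}$. Assume also that for all $Y\in\overline{\mathcal X}$ and all $x\in\mathcal X$ with $x_\theta\in\arg\min_{\mathcal X_\theta}f_\theta(\cdot,Y)$ for every $\theta$, the correspondence $\theta\mapsto\{g\in\partial_1f_\theta(x_\theta,Y):\langle g,y-x_\theta\rangle\ge0\ \forall y\in\mathcal X_\theta\}$ is measurable. Let $H(x)$ be the set of all $\mathbf g\in L^2([0,1],\mathbb R^T)$ with $\mathbf g_\theta\in\partial_1f_\theta(x_\theta,\int x)$ for a.e. $\theta$.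 A *variational Wardrop equilibrium* (VWE) of $\mathcal G(A)$ is an $x^*\in\mathcal X(A)$ for which some $\mathbf g\in H(x^*)$ satisfies $\int_\Theta\langle\mathbf g_\theta,x_\theta-x^*_\theta\rangle\,d\theta\ge0$ for all $x\in\mathcal X(A)$. The game $\mathcal G$ is *strongly monotone with modulus $\alpha$* (resp. *aggregatively strongly monotone with modulus $\beta$*) if $\int_\Theta\langle\mathbf g_\theta-\mathbf h_\theta,x_\theta-y_\theta\rangle\,d\theta$ is at least $\alpha\|x-y\|_2^2$ (resp. $\beta\|\int x-\int y\|^2$) for all $x,y\in L^2([0,1],\mathcal M)$, $\mathbf g\in H(x)$, $\mathbf h\in H(y)$. *Pseudo-AAS.* For each $\nu$ let $\mathcal G^\nu$ be a finite-player game with players $i\in\mathcal I^\nu$, nonempty convex compact action sets $\mathcal X^\nu_i\subset\mathbb R^T_+$ and costs $f^\nu_i(x_i,Y)$; put $\mathcal X^\nu=\prod_i\mathcal X^\nu_i$, $\overline{\mathcal X}^\nu=\{\sum_ix_i:x\in\mathcal X^\nu\}$ and $\mathcal X^\nu(A^\nu)=\{x\in\mathcal X^\nu:\sum_ix_i\in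 A^\nu\}$. Let $[0,1]=\Theta_0^\nu\cup\bigcup_{i\in\mathcal I^\nu}\Theta_i^\nu$ be a measurable partition in which $\Theta_0^\nu$ is null and $\mu_i^\nu=|\Theta^\nu_i|>0$ for $i\in\mathcal I^\nu$. As a function of its first variable, $f_i^\nu$ is defined on a set containing $\mathcal X_i^\nu$ and a neighbourhood of $\mu_i^\nu\mathcal M$; on this set it is convex in $x_i$ for every $Y\in\overline{\mathcal X}^\nu$, and it is jointly continuous in $(x_i,Y)$. The games form a pseudo-AAS of $\mathcal G$ if, as $\nu\to\infty$, $$\overline\delta^\nu=\max_i\sup_{\theta\in\Theta_i^\nu}d_H\big(\mathcal X_\theta,\tfrac1{\mu_i^\nu}\mathcal X_i^\nu\big)\to0,\qquad \overline d^\nu=\max_i\sup_{\theta\in\Theta_i^\nu}\sup_{x,Y\in\mathcal M}d_H\big(\partial_1f_i^\nu(\mu_i^\nu x,Y),\partial_1f_\theta(x,Y)\big)\to0,$$ and $\mathrm{span}\,\mathcal X_i^\nu=\mathrm{span}\,\mathcal X_\theta$ for all $\theta\in\Theta_i^\nu$. With aggregative constraints $A$ and $A^\nu$ (convex compact subsets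 of $\mathbb R^T$) one requires in addition $\mathrm{span}\,A^\nu=\mathrm{span}\,A$ for all $\nu$ and $D^\nu=d_H(A^\nu,A)\to0$. A *pseudo-VNE* of $\mathcal G^\nu(A^\nu)$ is an $\hat x\in\mathcal X^\nu(A^\nu)$ for which there are $\mathbf g_i\in\partial_1f_i^\nu(\hat x_i,\sum_j\hat x_j)$, $i\in\mathcal I^\nu$, with $\sum_i\langle\mathbf g_i,x_i-\hat x_i\rangle\ge0$ for all $x\in\mathcal X^\nu(A^\nu)$. Let $\psi^\nu(x)\in L^2([0,1],\mathbb R^T)$ be the function equal to $x_i/\mu_i^\nu$ on $\Theta_i^\nu$. *Claim with aggregative constraints.* Assume that there are $\eta>0$ and $\bar x\in\mathcal X$ with $d(\bar x_\theta,\mathrm{rbd}\,\mathcal X_\theta)>\eta$ for a.e. $\theta$, and let $A\subset\mathbb R^T$ be convex and compact with $\mathrm{ri}\,A\cap\mathrm{ri}\,\overline{\mathcal X}\neq\emptyset$. Then there are constants $\rho,\bar\rho>0$, depending only on $\mathcal G$ and $A$, such that with $K_A=\frac{M+1}{\min\{\rho,\bar\rho\}}$ the following holds for every pseudo-AAS $(\mathcal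 G^\nu(A^\nu))_\nu$ of $\mathcal G(A)$, every VWE $x^*$ of $\mathcal G(A)$ and all pseudo-VNE $\hat x^\nu$ of $\mathcal G^\nu(A^\nu)$, where $X^*=\int x^*$ and $\hat X^\nu=\sum_i\hat x^\nu_i$. (1) If $\mathcal G$ is aggregatively strongly monotone with modulus $\beta>0$, then $\hat X^\nu\to X^*$, and for all $\nu$ with $2\max(\overline\delta^\nu,D^\nu)<\rho$, $$\|\hat X^\nu-X^*\|^2\le\tfrac1\beta\big((3B_{\mathbf f}+1)K_A\max(D^\nu,\overline\delta^\nu)+(2M+1)\overline d^\nu\big).$$ (2) If $\mathcal G$ is strongly monotone with modulus $\alpha>0$, then $\psi^\nu(\hat x^\nu)\to x^*$ in $L^2$, and for all $\nu$ with $2\max(\overline\delta^\nu,D^\nu)<\rho$, $$\|\psi^\nu(\hat x^\nu)-x^*\|_2^2\le\tfrac1\alpha\big((3B_{\mathbf f}+1)K_A\max(D^\nu,\overline\delta^\nu)+(2M+1)\overline d^\nu\big).$$ *Claim without aggregative constraints* (that is, $\overline{\mathcal X}\subset A$ and $\overline{\mathcal X}^\nu\subset A^\nu$ for all $\nu$).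 There is $\rho>0$ such that (1) and (2) hold with $K_A$ replaced by $1$ and $D^\nu$ replaced by $0$; the hypotheses on $\eta$, $\bar x$, on the relative interiors and on the convergence of $A^\nu$ to $A$ are not needed here. -/

import Mathlib

open MeasureTheory Filter Topology
open scoped ENNReal Pointwise unitInterval RealInnerProductSpace

noncomputable section

namespace AggGame

/-- The action space `ℝ^T` with the Euclidean norm. -/
abbrev Act (T : ℕ) : Type := EuclideanSpace ℝ (Fin T)

/-- The cube `[0, M + 1]^T`. -/
def cube (T : ℕ) (M : ℝ) : Set (Act T) := {x | ∀ t, 0 ≤ x t ∧ x t ≤ M + 1}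

/-- The subdifferential at `x` of a function `φ` with domain `C`. -/
def subdiff {T : ℕ} (C : Set (Act T)) (φ : Act T → ℝ) (x : Act T) : Set (Act T) :=
  {g | ∀ z ∈ C, φ x + ⟪g, z - x⟫ ≤ φ z}

/-- The relative boundary of `C`: its boundary in the linear span of `C`. -/
def relBoundary {T : ℕ} (C : Set (Act T)) : Set (Act T) :=
  ((↑) : Submodule.span ℝ C → Act T) ''
    frontier (((↑) : Submodule.span ℝ C → Act T) ⁻¹' C)

/-- The set `L²([0,1], C)`. -/
def L2 {T : ℕ} (C : Set (Act T)) : Set (I → Act T) :=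
  {x | MemLp x 2 volume ∧ ∀ᵐ θ, x θ ∈ C}

/-! ### Nonatomic aggregative games -/

/-- A nonatomic aggregative game: the players are the points of `[0,1]` with Lebesgue measure,
player `θ` has the action set `act θ` and the cost `cost θ x Y` of the own action `x` at the
aggregate action `Y`; `dom` is the set on which the costs are considered as functions of the
own action. -/
structure NonatomicGame (T : ℕ) where
  act : I → Set (Act T)
  dom : Set (Act T)
  cost : I → Act T → Act T → ℝ

namespace NonatomicGame

variable {T : ℕ} (G : NonatomicGame T)

/-- The subdifferential `∂₁ f_θ(x, Y)` with respect to the own action. -/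
def subgrad (θ : I) (x Y : Act T) : Set (Act T) := subdiff G.dom (fun z => G.cost θ z Y) x

/-- Feasible pure-action profiles. -/
def profiles : Set (I → Act T) := {x | MemLp x 2 volume ∧ ∀ᵐ θ, x θ ∈ G.act θ}

/-- Feasible aggregate actions. -/
def aggregates : Set (Act T) := {Y | ∃ x ∈ G.profiles, ∫ θ, x θ = Y}

/-- Feasible pure-action profiles whose aggregate satisfies the constraint `A`. -/
def constrProfiles (A : Set (Act T)) : Set (I → Act T) := {x ∈ G.profiles | ∫ θ, x θ ∈ A}

/-- The correspondence `H`: square-integrable selections of subgradients along `x`. -/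
def H (x : I → Act T) : Set (I → Act T) :=
  {g | MemLp g 2 volume ∧ ∀ᵐ θ, g θ ∈ G.subgrad θ (x θ) (∫ ξ, x ξ)}

/-- Variational Wardrop equilibrium under the aggregative constraint `A`. -/
def IsVWE (A : Set (Act T)) (x : I → Act T) : Prop :=
  x ∈ G.constrProfiles A ∧
    ∃ g ∈ G.H x, ∀ y ∈ G.constrProfiles A, 0 ≤ ∫ θ, ⟪g θ, y θ - x θ⟫

/-- Strong monotonicity with modulus `α`. -/
def StronglyMonotone (M α : ℝ) : Prop :=
  ∀ x ∈ L2 (cube T M), ∀ y ∈ L2 (cube T M), ∀ g ∈ G.H x, ∀ h ∈ G.H y,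
    α * ∫ θ, ‖x θ - y θ‖ ^ 2 ≤ ∫ θ, ⟪g θ - h θ, x θ - y θ⟫

/-- Aggregatively strong monotonicity with modulus `β`. -/
def AggStronglyMonotone (M β : ℝ) : Prop :=
  ∀ x ∈ L2 (cube T M), ∀ y ∈ L2 (cube T M), ∀ g ∈ G.H x, ∀ h ∈ G.H y,
    β * ‖(∫ θ, x θ) - ∫ θ, y θ‖ ^ 2 ≤ ∫ θ, ⟪g θ - h θ, x θ - y θ⟫

/-- Nonatomic pure-action sets: nonempty, convex, compact, with nonnegative coordinates, in the
closed ball of radius `M` around `0`, with Borel graph. -/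
structure RegularActions (M : ℝ) : Prop where
  nonempty : ∀ θ, (G.act θ).Nonempty
  convex : ∀ θ, Convex ℝ (G.act θ)
  compact : ∀ θ, IsCompact (G.act θ)
  nonneg : ∀ θ, ∀ x ∈ G.act θ, ∀ t, 0 ≤ x t
  bounded : ∀ θ, G.act θ ⊆ Metric.closedBall 0 M
  graph : MeasurableSet {p : I × Act T | p.2 ∈ G.act p.1}

/-- Nonatomic convex costs, with subgradients bounded by `B`. -/
structure RegularCosts (M B : ℝ) : Prop where
  dom_nhds : G.dom ∈ 𝓝ˢ (cube T M)
  bounded : ∀ θ, ∃ C, ∀ x ∈ cube T M, ∀ Y ∈ cube T M, |G.cost θ x Y| ≤ C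
  measurable : ∀ Y ∈ cube T M, ∀ x ∈ G.dom, AEMeasurable (fun θ => G.cost θ x Y) volume
  continuous : ∀ Y ∈ cube T M, ∀ θ, ContinuousOn (fun x => G.cost θ x Y) G.dom
  convex : ∀ Y ∈ cube T M, ∀ θ, ConvexOn ℝ G.dom (fun x => G.cost θ x Y)
  subgrad_bound : ∀ θ, ∀ x ∈ cube T M, ∀ Y ∈ cube T M, ∀ g ∈ G.subgrad θ x Y, ‖g‖ ≤ B

/-- Continuity of the costs in the aggregate action. -/
def ContinuousInAggregate (M : ℝ) : Prop :=
  ∀ θ, ∀ x ∈ cube T M, ContinuousOn (fun Y => G.cost θ x Y) (cube T M)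

/-- The best-reply correspondence. -/
def bestReply (Y : Act T) : Set (I → Act T) :=
  {x ∈ G.profiles | ∀ θ, x θ ∈ G.act θ ∧ ∀ z ∈ G.act θ, G.cost θ (x θ) Y ≤ G.cost θ z Y}

/-- The subgradients at `x θ` which certify that `x θ` is a best reply to `Y`. -/
def replySubgrad (x : I → Act T) (Y : Act T) (θ : I) : Set (Act T) :=
  {g ∈ G.subgrad θ (x θ) Y | ∀ y ∈ G.act θ, 0 ≤ ⟪g, y - x θ⟫}

/-- For each best reply `x` to a feasible aggregate `Y`, the correspondence `replySubgrad x Y`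
is (Lebesgue) measurable. -/
def MeasurableReplySubgrad : Prop :=
  ∀ Y ∈ G.aggregates, ∀ x ∈ G.bestReply Y, ∀ F : Set (Act T), IsClosed F →
    NullMeasurableSet {θ | (G.replySubgrad x Y θ ∩ F).Nonempty} volume

/-- Some feasible profile stays at a distance larger than `η > 0` from the relative boundaries
of the action sets (the distance to the empty set is infinite). -/
def UniformInterior : Prop :=
  ∃ η : ℝ, 0 < η ∧ ∃ x ∈ G.profiles,
    ∀ᵐ θ, ENNReal.ofReal η < Metric.infEDist (x θ) (relBoundary (G.act θ))

end NonatomicGame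

/-! ### Finite-player aggregative games -/

/-- A finite-player aggregative game: player `i` has the action set `act i` and the cost
`cost i x Y` of the own action `x` at the aggregate action `Y`; `dom i` is the set on which this
cost is considered as a function of the own action. -/
structure FiniteGame (T : ℕ) where
  n : ℕ
  act : Fin n → Set (Act T)
  dom : Fin n → Set (Act T)
  cost : Fin n → Act T → Act T → ℝ

namespace FiniteGame

variable {T : ℕ} (F : FiniteGame T)

/-- The subdifferential `∂₁ f_i(x, Y)` with respect to the own action, at fixed aggregate. -/
def subgrad (i : Fin F.n) (x Y : Act T) : Set (Act T) :=
  subdiff (F.dom i) (fun z => F.cost i z Y) x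

/-- Feasible pure-action profiles. -/
def profiles : Set (Fin F.n → Act T) := {x | ∀ i, x i ∈ F.act i}

/-- Feasible aggregate actions. -/
def aggregates : Set (Act T) := {Y | ∃ x ∈ F.profiles, ∑ i, x i = Y}

/-- Feasible pure-action profiles whose aggregate satisfies the constraint `A`. -/
def constrProfiles (A : Set (Act T)) : Set (Fin F.n → Act T) := {x ∈ F.profiles | ∑ i, x i ∈ A}

/-- Pseudo-variational Nash equilibrium under the aggregative constraint `A`: the subgradients
are those of the costs at fixed aggregate action. -/
def IsPseudoVNE (A : Set (Act T)) (x : Fin F.n → Act T) : Prop :=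
  x ∈ F.constrProfiles A ∧
    ∃ g : Fin F.n → Act T, (∀ i, g i ∈ F.subgrad i (x i) (∑ j, x j)) ∧
      ∀ y ∈ F.constrProfiles A, 0 ≤ ∑ i, ⟪g i, y i - x i⟫

/-- Nonempty, convex and compact action sets, with nonnegative coordinates. -/
structure RegularActions : Prop where
  nonempty : ∀ i, (F.act i).Nonempty
  convex : ∀ i, Convex ℝ (F.act i)
  compact : ∀ i, IsCompact (F.act i)
  nonneg : ∀ i, ∀ x ∈ F.act i, ∀ t, 0 ≤ x t

/-- Convex pseudo-costs: the costs are jointly continuous, and convex in the own action at each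
fixed feasible aggregate action. -/
structure ConvexPseudoCosts : Prop where
  act_subset : ∀ i, F.act i ⊆ F.dom i
  continuous : ∀ i,
    ContinuousOn (fun p : Act T × Act T => F.cost i p.1 p.2) (F.dom i ×ˢ F.aggregates)
  convex : ∀ i, ∀ Y ∈ F.aggregates, ConvexOn ℝ (F.dom i) (fun x => F.cost i x Y)

end FiniteGame

/-! ### Pseudo atomic approximating sequences -/

/-- Measurable sets `Θ_1, …, Θ_n` of positive measure which, together with a null set `Θ_0`,
form a partition of `[0,1]`. -/
structure PlayerPartition (n : ℕ) where
  cell : Fin n → Set I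
  measurable : ∀ i, NullMeasurableSet (cell i) volume
  disjoint : Pairwise fun i j => Disjoint (cell i) (cell j)
  pos : ∀ i, 0 < volume (cell i)
  cover : volume (⋃ i, cell i)ᶜ = 0

namespace PlayerPartition

variable {n : ℕ} (P : PlayerPartition n)

/-- The Lebesgue measure `μ_i` of the cell `Θ_i`. -/
def weight (i : Fin n) : ℝ := volume.real (P.cell i)

/-- The nonatomic profile `ψ(x)`, equal to `x_i / μ_i` on the cell `Θ_i`. -/
def lift {T : ℕ} (x : Fin n → Act T) (θ : I) : Act T :=
  ∑ i, (P.cell i).indicator (fun _ => (P.weight i)⁻¹ • x i) θ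

end PlayerPartition

variable {T : ℕ}

/-- The largest Hausdorff distance between the action set of a nonatomic player and the rescaled
action set of the finite player who represents her. -/
def actionGap (G : NonatomicGame T) (F : FiniteGame T) (P : PlayerPartition F.n) : ℝ≥0∞ :=
  ⨆ i, ⨆ θ ∈ P.cell i, Metric.hausdorffEDist (G.act θ) ((P.weight i)⁻¹ • F.act i)

/-- The largest Hausdorff distance between the subdifferentials of a nonatomic player and those of
the finite player who represents her. -/
def subgradGap (M : ℝ) (G : NonatomicGame T) (F : FiniteGame T) (P : PlayerPartition F.n) :
    ℝ≥0∞ :=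
  ⨆ i, ⨆ θ ∈ P.cell i, ⨆ x ∈ cube T M, ⨆ Y ∈ cube T M,
    Metric.hausdorffEDist (F.subgrad i (P.weight i • x) Y) (G.subgrad θ x Y)

/-- The conditions on a pseudo atomic approximating sequence which do not involve the aggregative
constraints. -/
structure IsPseudoAAS (M : ℝ) (G : NonatomicGame T) (F : ℕ → FiniteGame T)
    (P : ∀ ν, PlayerPartition (F ν).n) : Prop where
  actions : ∀ ν, (F ν).RegularActions
  costs : ∀ ν, (F ν).ConvexPseudoCosts
  dom_nhds : ∀ ν i, (F ν).dom i ∈ 𝓝ˢ ((P ν).weight i • cube T M)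
  span_eq : ∀ ν i, ∀ θ ∈ (P ν).cell i,
    Submodule.span ℝ ((F ν).act i) = Submodule.span ℝ (G.act θ)
  actionGap_tendsto : Tendsto (fun ν => actionGap G (F ν) (P ν)) atTop (𝓝 0)
  subgradGap_tendsto : Tendsto (fun ν => subgradGap M G (F ν) (P ν)) atTop (𝓝 0)

/-- The condition on the aggregative constraint sets of a pseudo atomic approximating sequence. -/
structure ConstraintsConverge (A : Set (Act T)) (A' : ℕ → Set (Act T)) : Prop where
  convex : ∀ ν, Convex ℝ (A' ν)
  compact : ∀ ν, IsCompact (A' ν)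
  span_eq : ∀ ν, Submodule.span ℝ A = Submodule.span ℝ (A' ν)
  tendsto : Tendsto (fun ν => Metric.hausdorffEDist (A' ν) A) atTop (𝓝 0)

/-- The quantity `(3 B + 1) K max(D, δ) + (2 M + 1) d`. -/
def errorTerm (M B K : ℝ) (D δ d : ℝ≥0∞) : ℝ≥0∞ :=
  ENNReal.ofReal ((3 * B + 1) * K) * max D δ + ENNReal.ofReal (2 * M + 1) * d

end AggGame

end

/-!
A pseudo-Nash profile `x̂` lifts to the step function `ψ(x̂)` with values `x̂ᵢ / μᵢ`. Measurable
nearest-point selections, together with averages over the cells, turn every profile of one game into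
a profile of the other one at distance `O(δ)`, and turn the Nash subgradients into an element of
`H(ψ(x̂))` at distance `d`. Testing each equilibrium's variational inequality on a profile close to
the other equilibrium and adding the two bounds `∫ ⟪h - g, ψ(x̂) - x*⟫`, with `h ∈ H(ψ(x̂))` and
`g ∈ H(x*)`, by the error term; strong monotonicity bounds it from below.

With aggregative constraints the approximating profiles must moreover be feasible. Since the
relative interiors of `A` and of the aggregates `X̄` meet, `A - X̄` contains a ball of radius `r` of
its span, so a profile whose aggregate is within `ε` of `A` becomes feasible after a convex
combination of weight `O(ε / r)`. For the approximating games a slightly smaller ball survives in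
`A' - X̄'`: a missing point could be strictly separated from this convex set.
-/

namespace AggGame

section AnalyticSets

theorem isCompact_Iic {α : Type*} [Preorder α] [OrderBot α] [TopologicalSpace α]
    [CompactIccSpace α] (a : α) : IsCompact (Set.Iic a) := by
  rw [← Set.Icc_bot]
  exact isCompact_Icc

theorem exists_initial_box_subset {k : ℕ → ℕ} {V : Set (ℕ → ℕ)} (hV : IsOpen V)
    (hkV : Set.Iic k ⊆ V) : ∃ n, {x : ℕ → ℕ | ∀ i < n, x i ≤ k i} ⊆ V := by
  let := PiNat.metricSpaceNatNat
  obtain ⟨ε, hε, hεV⟩ := (isCompact_Iic k).exists_thickening_subset_open hV hkV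
  obtain ⟨n, hn⟩ := exists_pow_lt_of_lt_one hε one_half_lt_one
  refine ⟨n, fun x hx => hεV (Metric.mem_thickening_iff.2 ⟨x ⊓ k, Set.mem_Iic.2 inf_le_right, ?_⟩)⟩
  refine (PiNat.mem_cylinder_iff_dist_le.1 fun i hi => ?_).trans_lt hn
  exact (min_eq_left (hx i hi)).symm

variable {α : Type*} [MeasurableSpace α] {μ : Measure α} {c : ℝ≥0∞}

theorem exists_lt_measure_image_inter_le {β : Type*} (f : β → α) (g : β → ℕ) {S : Set β}
    (hc : c < μ (f '' S)) : ∃ m, c < μ (f '' (S ∩ {x | g x ≤ m})) := by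
  have hmono : Monotone fun m => f '' (S ∩ {x | g x ≤ m}) := fun a b hab =>
    Set.image_mono (Set.inter_subset_inter_right _ fun x (hx : g x ≤ a) => hx.trans hab)
  have hS : S = ⋃ m, S ∩ {x | g x ≤ m} := by
    rw [← Set.inter_iUnion, Set.iUnion_eq_univ_iff.2 fun x => ⟨g x, le_refl (g x)⟩, Set.inter_univ]
  rwa [hS, Set.image_iUnion, hmono.measure_iUnion, lt_iSup_iff] at hc

theorem exists_forall_lt_measure_image_initial_box {f : (ℕ → ℕ) → α}
    (hc : c < μ (Set.range f)) :
    ∃ k : ℕ → ℕ, ∀ n, c < μ (f '' {x | ∀ i < n, x i ≤ k i}) := by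
  choose! m hm using fun (n : ℕ) (S : Set (ℕ → ℕ)) (hS : c < μ (f '' S)) =>
    exists_lt_measure_image_inter_le f (fun x => x n) hS
  let S : ℕ → Set (ℕ → ℕ) := fun n => n.rec Set.univ fun n S => S ∩ {x | x n ≤ m n S}
  have hS : ∀ n, S n = {x | ∀ i < n, x i ≤ m i (S i)} := by
    intro n
    induction n with
    | zero => simp [S]
    | succ n ih =>
      ext x
      rw [Set.mem_ofPred_eq, Nat.forall_lt_succ_right]
      exact and_congr_left' (Set.ext_iff.1 ih x)
  refine ⟨fun i => m i (S i), fun n => ?_⟩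
  rw [← hS n]
  induction n with
  | zero => simpa [S] using hc
  | succ n ih => exact hm n _ ih

variable [TopologicalSpace α]

theorem exists_isCompact_subset_of_lt_measure_range [μ.OuterRegular] {f : (ℕ → ℕ) → α}
    (hf : Continuous f) (hc : c < μ (Set.range f)) :
    ∃ L ⊆ Set.range f, IsCompact L ∧ c ≤ μ L := by
  obtain ⟨k, hk⟩ := exists_forall_lt_measure_image_initial_box hc
  refine ⟨f '' Set.Iic k, Set.image_subset_range _ _, (isCompact_Iic k).image hf, ?_⟩
  by_contra! hlt
  obtain ⟨U, hKU, hU, hUc⟩ := Set.exists_isOpen_lt_of_lt _ _ hlt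
  obtain ⟨n, hn⟩ := exists_initial_box_subset (hU.preimage hf) (Set.image_subset_iff.1 hKU)
  exact ((hk n).trans_le (measure_mono (Set.image_subset_iff.2 hn))).not_gt hUc

theorem nullMeasurableSet_of_analyticSet [T2Space α] [BorelSpace α] [IsFiniteMeasure μ]
    [μ.OuterRegular] {s : Set α} (hs : AnalyticSet s) : NullMeasurableSet s μ := by
  rw [AnalyticSet] at hs
  obtain rfl | ⟨f, hf, rfl⟩ := hs
  · exact nullMeasurableSet_empty
  obtain h0 | hpos := eq_zero_or_pos (μ (Set.range f))
  · exact .of_null h0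
  obtain ⟨u, -, hu, hlim⟩ := exists_seq_strictMono_tendsto' hpos
  choose L hL hLc hLm using fun n => exists_isCompact_subset_of_lt_measure_range hf (hu n).2
  have hmeas : NullMeasurableSet (⋃ n, L n) μ :=
    (MeasurableSet.iUnion fun n => (hLc n).measurableSet).nullMeasurableSet
  refine hmeas.congr (ae_eq_of_subset_of_measure_ge (Set.iUnion_subset hL) ?_ hmeas
    (measure_ne_top _ _))
  exact le_of_tendsto' hlim fun n => (hLm n).trans (measure_mono (Set.subset_iUnion L n))

end AnalyticSets

section NearestPoint

theorem exists_mem_edist_eq_infEDist {E : Type*} [PseudoMetricSpace E] [ProperSpace E] {S : Set E}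
    (hS : IsClosed S) (hne : S.Nonempty) (c : E) : ∃ x ∈ S, edist c x = Metric.infEDist c S := by
  obtain ⟨x, hx, hxc⟩ := hS.exists_infDist_eq_dist hne c
  refine ⟨x, hx, ?_⟩
  rw [edist_dist, ← hxc, Metric.infDist, ENNReal.ofReal_toReal (Metric.infEDist_ne_top hne)]

theorem eq_of_edist_eq_infEDist {E : Type*} [NormedAddCommGroup E] [NormedSpace ℝ E]
    [StrictConvexSpace ℝ E] {S : Set E} (hS : Convex ℝ S) {c x y : E} (hx : x ∈ S) (hy : y ∈ S)
    (hxc : edist c x = Metric.infEDist c S) (hyc : edist c y = Metric.infEDist c S) : x = y := by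
  by_contra hne
  have hnorm : ‖x - c‖ = ‖y - c‖ := by
    rw [← hyc, edist_comm c, edist_comm c, edist_eq_enorm_sub, edist_eq_enorm_sub] at hxc
    exact congrArg ENNReal.toReal hxc
  have hmid : (1 / 2 : ℝ) • x + (1 / 2 : ℝ) • y ∈ S :=
    hS hx hy (by norm_num) (by norm_num) (by norm_num)
  have hle := hxc.trans_le (Metric.infEDist_le_edist_of_mem hmid)
  rw [edist_comm c, edist_comm c, edist_eq_enorm_sub, edist_eq_enorm_sub, enorm_le_iff_norm_le]
    at hle
  refine hle.not_gt (lt_of_eq_of_lt (congrArg norm ?_)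
    ((norm_midpoint_lt_iff hnorm).2 (sub_left_injective.ne hne)))
  module

theorem infEDist_inter_le_iff_mem {E : Type*} [NormedAddCommGroup E] [NormedSpace ℝ E]
    [StrictConvexSpace ℝ E] [ProperSpace E] {S F : Set E} (hS : IsClosed S) (hSconv : Convex ℝ S)
    (hF : IsClosed F) {c p : E} (hp : p ∈ S) (hpc : edist c p = Metric.infEDist c S) :
    Metric.infEDist c (S ∩ F) ≤ Metric.infEDist c S ↔ p ∈ F := by
  refine ⟨fun hle => ?_, fun hpF =>
    (Metric.infEDist_le_edist_of_mem (Set.mem_inter hp hpF)).trans_eq hpc⟩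
  have hfin := ne_top_of_le_ne_top (Metric.infEDist_ne_top (x := c) (Set.nonempty_of_mem hp)) hle
  have hne : (S ∩ F).Nonempty := by
    by_contra hempty
    simp [Set.not_nonempty_iff_eq_empty.1 hempty] at hfin
  obtain ⟨q, ⟨hqS, hqF⟩, hqc⟩ := exists_mem_edist_eq_infEDist (hS.inter hF) hne c
  have hqc' := (hqc.trans_le hle).antisymm (Metric.infEDist_le_edist_of_mem hqS)
  rwa [eq_of_edist_eq_infEDist hSconv hp hqS hpc hqc']

end NearestPoint

section MeasurableCorrespondences

variable {Ω E : Type*} [MeasurableSpace Ω] {μ : Measure Ω}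

/-- Measurability of a correspondence `S` with respect to the completion of `μ`: the set of points
whose value meets a given closed set is measurable up to a null set. -/
def NullMeasurableCorr [TopologicalSpace E] (S : Ω → Set E) (μ : Measure Ω) : Prop :=
  ∀ F : Set E, IsClosed F → NullMeasurableSet {ω | (S ω ∩ F).Nonempty} μ

theorem nullMeasurableCorr_of_measurableSet_graph [TopologicalSpace Ω] [PolishSpace Ω]
    [BorelSpace Ω] [IsFiniteMeasure μ] [TopologicalSpace E] [PolishSpace E] [MeasurableSpace E]
    [BorelSpace E] {S : Ω → Set E} (hS : MeasurableSet {p : Ω × E | p.2 ∈ S p.1}) :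
    NullMeasurableCorr S μ := by
  intro F hF
  have hproj : {ω | (S ω ∩ F).Nonempty} =
      Prod.fst '' ({p : Ω × E | p.2 ∈ S p.1} ∩ Prod.snd ⁻¹' F) := by
    ext ω
    simp [Set.Nonempty]
  rw [hproj]
  let := TopologicalSpace.upgradeIsCompletelyMetrizable Ω
  exact nullMeasurableSet_of_analyticSet
    ((hS.inter (measurable_snd hF.measurableSet)).analyticSet_image measurable_fst)

namespace NullMeasurableCorr

section TopologicalSpace

variable [TopologicalSpace E] {S S' : Ω → Set E}

theorem congr (hS : NullMeasurableCorr S μ) (h : ∀ᵐ ω ∂μ, S ω = S' ω) :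
    NullMeasurableCorr S' μ := fun F hF =>
  (hS F hF).congr (eventuallyEq_set.2 (h.mono fun ω hω => by
    simp only [Set.mem_ofPred_eq, hω]))

theorem inter_isClosed (hS : NullMeasurableCorr S μ) {K : Set E} (hK : IsClosed K) :
    NullMeasurableCorr (fun ω => S ω ∩ K) μ := fun F hF => by
  simpa only [Set.inter_assoc] using hS (K ∩ F) (hK.inter hF)

theorem of_cover {ι : Type*} [Countable ι] {s : ι → Set Ω} {S' : ι → Ω → Set E}
    (hs : ∀ i, NullMeasurableSet (s i) μ) (hcover : ∀ᵐ ω ∂μ, ∃ i, ω ∈ s i)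
    (hS' : ∀ i, NullMeasurableCorr (S' i) μ) (h : ∀ i, ∀ ω ∈ s i, S ω = S' i ω) :
    NullMeasurableCorr S μ := fun F hF => by
  refine (NullMeasurableSet.iUnion fun i => (hs i).inter (hS' i F hF)).congr
    (eventuallyEq_set.2 ?_)
  filter_upwards [hcover] with ω ⟨i, hi⟩
  simp only [Set.mem_iUnion, Set.mem_inter_iff, Set.mem_ofPred_eq]
  exact ⟨fun ⟨j, hj, hjF⟩ => by rwa [h j ω hj], fun hω => ⟨i, hi, by rwa [← h i ω hi]⟩⟩

end TopologicalSpace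

theorem nullMeasurable_infEDist_const [PseudoEMetricSpace E] {S : Ω → Set E}
    (hS : NullMeasurableCorr S μ) (c : E) :
    NullMeasurable (fun ω => Metric.infEDist c (S ω)) μ := by
  have hIio : ∀ a, NullMeasurableSet ((fun ω => Metric.infEDist c (S ω)) ⁻¹' Set.Iio a) μ := by
    intro a
    obtain ⟨K, hK, -, hKU, -⟩ := (Metric.isOpen_eball (x := c) (ε := a)).exists_iUnion_isClosed
    convert NullMeasurableSet.iUnion fun n => hS (K n) (hK n)
    ext ω
    simp only [Set.mem_preimage, Set.mem_Iio, Metric.infEDist_lt_iff, Set.mem_iUnion,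
      Set.mem_ofPred_eq]
    rw [← Set.nonempty_iUnion, ← Set.inter_iUnion, hKU]
    simp only [Set.Nonempty, Set.mem_inter_iff, Metric.mem_eball']
  have hm : Measurable fun ω : NullMeasurableSpace Ω μ => Metric.infEDist c (S ω) :=
    measurable_of_Iio hIio
  exact fun s hs => hm hs

theorem aemeasurable_infEDist [EMetricSpace E] [SecondCountableTopology E] [MeasurableSpace E]
    [BorelSpace E] {S : Ω → Set E} (hS : NullMeasurableCorr S μ) {c : Ω → E}
    (hc : AEMeasurable c μ) : AEMeasurable (fun ω => Metric.infEDist (c ω) (S ω)) μ := by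
  have hjoint : Measurable (Function.uncurry fun (x : E) (ω : NullMeasurableSpace Ω μ) =>
      Metric.infEDist x (S ω)) :=
    measurable_uncurry_of_continuous_of_measurable (fun _ => Metric.continuous_infEDist)
      fun x s hs => hS.nullMeasurable_infEDist_const x hs
  have hc' : Measurable (fun ω : NullMeasurableSpace Ω μ => c ω) := fun s hs =>
    hc.nullMeasurable hs
  have hcomp : Measurable fun ω : NullMeasurableSpace Ω μ => Metric.infEDist (c ω) (S ω) :=
    hjoint.comp (hc'.prodMk measurable_id)
  exact NullMeasurable.aemeasurable fun s hs => hcomp hs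

variable [NormedAddCommGroup E] [NormedSpace ℝ E] [StrictConvexSpace ℝ E] [ProperSpace E]
  [MeasurableSpace E] [BorelSpace E]

theorem exists_aemeasurable_nearest {S : Ω → Set E} (hS : NullMeasurableCorr S μ)
    (hclosed : ∀ᵐ ω ∂μ, IsClosed (S ω)) (hconvex : ∀ᵐ ω ∂μ, Convex ℝ (S ω))
    (hne : ∀ᵐ ω ∂μ, (S ω).Nonempty) {c : Ω → E} (hc : AEMeasurable c μ) :
    ∃ p : Ω → E, AEMeasurable p μ ∧
      ∀ᵐ ω ∂μ, p ω ∈ S ω ∧ edist (c ω) (p ω) = Metric.infEDist (c ω) (S ω) := by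
  choose! p hp using fun ω (h : IsClosed (S ω) ∧ (S ω).Nonempty) =>
    exists_mem_edist_eq_infEDist h.1 h.2 (c ω)
  have hp' : ∀ᵐ ω ∂μ, p ω ∈ S ω ∧ edist (c ω) (p ω) = Metric.infEDist (c ω) (S ω) := by
    filter_upwards [hclosed, hne] with ω hcl hn using hp ω ⟨hcl, hn⟩
  refine ⟨p, ?_, hp'⟩
  -- By uniqueness of nearest points, `p ω ∈ F` says that `S ω ∩ F` is as close to `c ω` as `S ω`.
  have hpre : ∀ F, IsClosed F → NullMeasurableSet (p ⁻¹' F) μ := by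
    intro F hF
    refine (nullMeasurableSet_le ((hS.inter_isClosed hF).aemeasurable_infEDist hc)
      (hS.aemeasurable_infEDist hc)).congr (eventuallyEq_set.2 ?_)
    filter_upwards [hclosed, hconvex, hp'] with ω hcl hcv ⟨hpS, hpc⟩
    exact infEDist_inter_le_iff_mem hcl hcv hF hpS hpc
  have hm : Measurable fun ω : NullMeasurableSpace Ω μ => p ω := measurable_of_isClosed hpre
  exact NullMeasurable.aemeasurable fun s hs => hm hs

end NullMeasurableCorr

end MeasurableCorrespondences

section Subdifferential

variable {T : ℕ} {C : Set (Act T)} {φ : Act T → ℝ} {x : Act T}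

theorem subdiff_eq_iInter_halfSpace :
    subdiff C φ x = ⋂ z ∈ C, {g | innerSL ℝ (z - x) g ≤ φ z - φ x} := by
  ext g
  simp only [subdiff, Set.mem_ofPred_eq, Set.mem_iInter, innerSL_apply_apply,
    real_inner_comm g, le_sub_iff_add_le']

theorem isClosed_subdiff : IsClosed (subdiff C φ x) := by
  rw [subdiff_eq_iInter_halfSpace]
  exact isClosed_biInter fun z _ =>
    isClosed_le (innerSL ℝ (z - x)).continuous continuous_const

theorem convex_subdiff : Convex ℝ (subdiff C φ x) := by
  rw [subdiff_eq_iInter_halfSpace]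
  exact convex_iInter₂ fun z _ =>
    convex_halfSpace_le (innerSL ℝ (z - x)).toLinearMap.isLinear _

theorem subdiff_eq_of_subset_closure {D : Set (Act T)} (hφ : ContinuousOn φ C) (hDC : D ⊆ C)
    (hCD : C ⊆ closure D) : subdiff D φ x = subdiff C φ x := by
  refine subset_antisymm (fun g hg z hz => ?_) fun g hg z hz => hg z (hDC hz)
  have := mem_closure_iff_nhdsWithin_neBot.1 (hCD hz)
  refine le_of_tendsto_of_tendsto (f := fun w => φ x + ⟪g, w - x⟫) ?_
    ((hφ z hz).mono hDC) (eventually_mem_nhdsWithin.mono hg)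
  exact ((by fun_prop : Continuous fun w => φ x + ⟪g, w - x⟫).tendsto z).mono_left
    nhdsWithin_le_nhds

theorem measurableSet_graph_subdiff {Ω : Type*} [MeasurableSpace Ω] {f : Ω → Act T → ℝ}
    (hC : C.Countable) (hx : Measurable fun ω => f ω x)
    (hf : ∀ z ∈ C, Measurable fun ω => f ω z) :
    MeasurableSet {p : Ω × Act T | p.2 ∈ subdiff C (f p.1) x} := by
  change MeasurableSet {p : Ω × Act T | ∀ z ∈ C, f p.1 x + ⟪p.2, z - x⟫ ≤ f p.1 z}
  simp only [Set.ofPred_forall]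
  refine .biInter hC fun z hz => measurableSet_le ?_ ((hf z hz).comp measurable_fst)
  exact (hx.comp measurable_fst).add (measurable_snd.inner measurable_const)

theorem nullMeasurableCorr_subdiff {Ω : Type*} [TopologicalSpace Ω] [PolishSpace Ω]
    [MeasurableSpace Ω] [BorelSpace Ω] {μ : Measure Ω} [IsFiniteMeasure μ] {f : Ω → Act T → ℝ}
    (hx : x ∈ C) (hm : ∀ z ∈ C, AEMeasurable (fun ω => f ω z) μ)
    (hcont : ∀ ω, ContinuousOn (f ω) C) :
    NullMeasurableCorr (fun ω => subdiff C (f ω) x) μ := by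
  obtain ⟨D, hDC, hD, hCD⟩ :=
    (TopologicalSpace.IsSeparable.of_separableSpace C).exists_countable_dense_subset
  have hD' : insert x D ⊆ C := Set.insert_subset hx hDC
  choose! f' hf' hff' using hm
  have hgraph := nullMeasurableCorr_of_measurableSet_graph (μ := μ)
    (S := fun ω => subdiff (insert x D) (fun z => f' z ω) x)
    (measurableSet_graph_subdiff (hD.insert x) (hf' x hx) fun z hz => hf' z (hD' hz))
  refine hgraph.congr ?_
  filter_upwards [(ae_ball_iff (hD.insert x)).2 fun z hz => hff' z (hD' hz)] with ω hω
  rw [← subdiff_eq_of_subset_closure (hcont ω) hD'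
    (hCD.trans (closure_mono (Set.subset_insert x D)))]
  ext g
  refine forall₂_congr fun z hz => ?_
  rw [hω z hz, hω x (Set.mem_insert x D)]

end Subdifferential

section InnerProduct

variable {Ω E : Type*} [MeasurableSpace Ω] {μ : Measure Ω} [NormedAddCommGroup E]
  [InnerProductSpace ℝ E] {f g : Ω → E} {a b : ℝ}

theorem integrable_inner_of_memLp_two (hf : MemLp f 2 μ) (hg : MemLp g 2 μ) :
    Integrable (fun ω => ⟪f ω, g ω⟫) μ :=
  (hf.norm.integrable_mul hg.norm).mono' (hf.1.inner hg.1)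
    (.of_forall fun _ => norm_inner_le_norm _ _)

theorem integral_inner_le_mul [IsProbabilityMeasure μ] (hf : ∀ᵐ ω ∂μ, ‖f ω‖ ≤ a)
    (hg : ∀ᵐ ω ∂μ, ‖g ω‖ ≤ b) : ∫ ω, ⟪f ω, g ω⟫ ∂μ ≤ a * b := by
  have h : ∀ᵐ ω ∂μ, ‖⟪f ω, g ω⟫‖ ≤ a * b := by
    filter_upwards [hf, hg] with ω hfω hgω
    exact (norm_inner_le_norm _ _).trans
      (mul_le_mul hfω hgω (norm_nonneg _) ((norm_nonneg _).trans hfω))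
  simpa using (le_abs_self _).trans (norm_integral_le_of_norm_le_const h)

theorem norm_integral_sub_le [IsProbabilityMeasure μ] (hf : Integrable f μ) (hg : Integrable g μ)
    (h : ∀ᵐ ω ∂μ, ‖f ω - g ω‖ ≤ a) : ‖(∫ ω, f ω ∂μ) - ∫ ω, g ω ∂μ‖ ≤ a := by
  rw [← integral_sub hf hg]
  simpa using norm_integral_le_of_norm_le_const h

end InnerProduct

namespace PlayerPartition

variable {n T : ℕ} (P : PlayerPartition n) {E : Type*} [NormedAddCommGroup E]

/-- The step function equal to `c i` on the cell `Θ_i`; the lift of `x` is the one with values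
`x_i / μ_i`. -/
noncomputable def step (c : Fin n → E) (θ : I) : E := ∑ i, (P.cell i).indicator (fun _ => c i) θ

theorem step_apply (c : Fin n → E) {i : Fin n} {θ : I} (hθ : θ ∈ P.cell i) :
    P.step c θ = c i := by
  rw [step, Finset.sum_eq_single i, Set.indicator_of_mem hθ]
  · exact fun j _ hj =>
      Set.indicator_of_notMem (fun h => Set.disjoint_left.1 (P.disjoint hj) h hθ) _
  · simp

theorem lift_apply (x : Fin n → Act T) {i : Fin n} {θ : I} (hθ : θ ∈ P.cell i) :
    P.lift x θ = (P.weight i)⁻¹ • x i :=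
  P.step_apply (fun i => (P.weight i)⁻¹ • x i) hθ

theorem ae_mem_cell : ∀ᵐ θ, ∃ i, θ ∈ P.cell i := by
  filter_upwards [show ⋃ i, P.cell i ∈ ae volume from mem_ae_iff.2 P.cover] with θ hθ
  exact Set.mem_iUnion.1 hθ

theorem weight_pos (i : Fin n) : 0 < P.weight i :=
  ENNReal.toReal_pos (P.pos i).ne' (measure_ne_top _ _)

theorem exists_mem_cell_of_ae {p : I → Prop} (h : ∀ᵐ θ, p θ) (i : Fin n) :
    ∃ θ ∈ P.cell i, p θ :=
  ((frequently_ae_mem_iff.2 (P.pos i).ne').and_eventually h).exists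

theorem inv_weight_smul_mem_of_ae_lift_mem {x : Fin n → Act T} {S : Set (Act T)}
    (h : ∀ᵐ θ, P.lift x θ ∈ S) (i : Fin n) : (P.weight i)⁻¹ • x i ∈ S := by
  obtain ⟨θ, hi, hθ⟩ := P.exists_mem_cell_of_ae h i
  rwa [P.lift_apply x hi] at hθ

theorem memLp_step (c : Fin n → E) (p : ℝ≥0∞) : MemLp (P.step c) p volume := by
  refine .of_bound (Finset.aestronglyMeasurable_fun_sum _ fun i _ =>
    aestronglyMeasurable_const.indicator₀ (P.measurable i)) (∑ i, ‖c i‖) (.of_forall fun θ => ?_)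
  exact norm_sum_le_of_le _ fun i _ => norm_indicator_le_norm_self _ _

theorem memLp_lift (x : Fin n → Act T) (p : ℝ≥0∞) : MemLp (P.lift x) p volume :=
  P.memLp_step _ p

section Integral

variable [NormedSpace ℝ E] {f : I → E}

theorem integral_eq_sum (hf : Integrable f) : ∫ θ, f θ = ∑ i, ∫ θ in P.cell i, f θ := by
  have hsum := integral_iUnion_ae P.measurable
    (fun i j hij => (P.disjoint hij).aedisjoint) hf.integrableOn
  rwa [Measure.restrict_eq_self_of_ae_mem (by simpa only [Set.mem_iUnion] using P.ae_mem_cell),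
    tsum_fintype] at hsum

theorem sum_weight : ∑ i, P.weight i = 1 := by
  simpa [weight] using (P.integral_eq_sum (integrable_const (1 : ℝ))).symm

theorem setIntegral_lift (x : Fin n → Act T) (i : Fin n) :
    ∫ θ in P.cell i, P.lift x θ = x i := by
  rw [setIntegral_congr_ae₀ (P.measurable i) (.of_forall fun θ => P.lift_apply x),
    setIntegral_const]
  exact smul_inv_smul₀ (P.weight_pos i).ne' _

theorem integral_lift (x : Fin n → Act T) : ∫ θ, P.lift x θ = ∑ i, x i := by
  rw [P.integral_eq_sum ((P.memLp_lift x 1).integrable le_rfl)]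
  exact Finset.sum_congr rfl fun i _ => P.setIntegral_lift x i

theorem norm_sum_sub_integral_le {y : Fin n → E} (hf : Integrable f) {c : ℝ}
    (h : ∀ i, ‖y i - ∫ θ in P.cell i, f θ‖ ≤ P.weight i * c) : ‖∑ i, y i - ∫ θ, f θ‖ ≤ c := by
  rw [P.integral_eq_sum hf, ← Finset.sum_sub_distrib]
  refine (norm_sum_le_of_le _ fun i _ => h i).trans_eq ?_
  rw [← Finset.sum_mul, P.sum_weight, one_mul]

end Integral

section Inner

variable [InnerProductSpace ℝ E] {γ u : Fin n → E} {b c : ℝ}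

theorem integral_inner_step [CompleteSpace E] (γ : Fin n → E) {f : I → E} (hf : Integrable f) :
    ∫ θ, ⟪P.step γ θ, f θ⟫ = ∑ i, ⟪γ i, ∫ θ in P.cell i, f θ⟫ := by
  have hbound : ∀ θ, ‖P.step γ θ‖ ≤ ∑ i, ‖γ i‖ := fun θ =>
    norm_sum_le_of_le _ fun i _ => norm_indicator_le_norm_self _ _
  have hint : Integrable (fun θ => ⟪P.step γ θ, f θ⟫) :=
    (hf.norm.const_mul (∑ i, ‖γ i‖)).mono' ((P.memLp_step γ 1).1.inner hf.1) <|
      .of_forall fun θ => (norm_inner_le_norm _ _).trans (by gcongr; exact hbound θ)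
  rw [P.integral_eq_sum hint]
  refine Finset.sum_congr rfl fun i _ => ?_
  rw [← integral_inner hf.integrableOn, setIntegral_congr_ae₀ (P.measurable i)]
  exact .of_forall fun θ hθ => by rw [P.step_apply γ hθ]

theorem sum_inner_le_mul (hγ : ∀ i, ‖γ i‖ ≤ b) (hu : ∀ i, ‖u i‖ ≤ P.weight i * c) :
    ∑ i, ⟪γ i, u i⟫ ≤ b * c := calc
  ∑ i, ⟪γ i, u i⟫ ≤ ∑ i, b * (P.weight i * c) := Finset.sum_le_sum fun i _ =>
    (real_inner_le_norm _ _).trans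
      (mul_le_mul (hγ i) (hu i) (norm_nonneg _) ((norm_nonneg _).trans (hγ i)))
  _ = b * c := by rw [← Finset.mul_sum, ← Finset.sum_mul, P.sum_weight, one_mul]

end Inner

end PlayerPartition

section Cube

variable {T : ℕ} {M : ℝ} {x : Act T}

theorem mem_cube_of_norm_le (h0 : ∀ t, 0 ≤ x t) (h : ‖x‖ ≤ M + 1) : x ∈ cube T M := fun t =>
  ⟨h0 t, (le_abs_self _).trans ((PiLp.norm_apply_le x t).trans h)⟩

theorem cube_eq_iInter_halfSpace :
    cube T M = ⋂ t, {x | 0 ≤ EuclideanSpace.proj (𝕜 := ℝ) t x} ∩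
      {x | EuclideanSpace.proj (𝕜 := ℝ) t x ≤ M + 1} := by
  ext x
  simp [cube]

theorem isClosed_cube : IsClosed (cube T M) := by
  rw [cube_eq_iInter_halfSpace]
  exact isClosed_iInter fun t => (isClosed_le continuous_const (by fun_prop)).inter
    (isClosed_le (by fun_prop) continuous_const)

theorem convex_cube : Convex ℝ (cube T M) := by
  rw [cube_eq_iInter_halfSpace]
  exact convex_iInter fun t =>
    (convex_halfSpace_ge (EuclideanSpace.proj t).toLinearMap.isLinear _).inter
      (convex_halfSpace_le (EuclideanSpace.proj t).toLinearMap.isLinear _)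

theorem integral_mem_cube {x : I → Act T} (hx : x ∈ L2 (cube T M)) : ∫ θ, x θ ∈ cube T M :=
  convex_cube.integral_mem isClosed_cube hx.2 (hx.1.integrable one_le_two)

end Cube

section ProfileApproximation

variable {T : ℕ} {M δ d : ℝ} {G : NonatomicGame T} {F : FiniteGame T} {P : PlayerPartition F.n}

namespace NonatomicGame.RegularActions

theorem norm_le (hact : G.RegularActions M) {θ : I} {x : Act T} (hx : x ∈ G.act θ) : ‖x‖ ≤ M :=
  mem_closedBall_zero_iff.1 (hact.bounded θ hx)

theorem bound_nonneg (hact : G.RegularActions M) : 0 ≤ M :=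
  (norm_nonneg _).trans (hact.norm_le (hact.nonempty 0).some_mem)

theorem profiles_subset_L2 (hact : G.RegularActions M) : G.profiles ⊆ L2 (cube T M) := fun _ hx =>
  ⟨hx.1, hx.2.mono fun θ h =>
    mem_cube_of_norm_le (hact.nonneg θ _ h) ((hact.norm_le h).trans (by linarith))⟩

end NonatomicGame.RegularActions

theorem hausdorffEDist_act_le_actionGap {i : Fin F.n} {θ : I} (hθ : θ ∈ P.cell i) :
    Metric.hausdorffEDist (G.act θ) ((P.weight i)⁻¹ • F.act i) ≤ actionGap G F P :=
  le_iSup_of_le i (le_iSup₂_of_le θ hθ le_rfl)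

theorem hausdorffEDist_subgrad_le_subgradGap {i : Fin F.n} {θ : I} (hθ : θ ∈ P.cell i)
    {x Y : Act T} (hx : x ∈ cube T M) (hY : Y ∈ cube T M) :
    Metric.hausdorffEDist (F.subgrad i (P.weight i • x) Y) (G.subgrad θ x Y) ≤
      subgradGap M G F P :=
  le_iSup_of_le i (le_iSup₂_of_le θ hθ (le_iSup₂_of_le x hx (le_iSup₂_of_le Y hY le_rfl)))

theorem infEDist_lift_le (h : actionGap G F P ≤ ENNReal.ofReal δ) {x : Fin F.n → Act T}
    (hx : x ∈ F.profiles) : ∀ᵐ θ, Metric.infEDist (P.lift x θ) (G.act θ) ≤ ENNReal.ofReal δ := by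
  filter_upwards [P.ae_mem_cell] with θ ⟨i, hi⟩
  rw [P.lift_apply x hi]
  refine (Metric.infEDist_le_hausdorffEDist_of_mem (Set.smul_mem_smul_set (hx i))).trans ?_
  rw [Metric.hausdorffEDist_comm]
  exact (hausdorffEDist_act_le_actionGap hi).trans h

/-- The nearest point selection is measurable, so it is a profile. -/
theorem exists_profile_near_lift (hact : G.RegularActions M) (hδ : 0 ≤ δ)
    (h : actionGap G F P ≤ ENNReal.ofReal δ) {x : Fin F.n → Act T} (hx : x ∈ F.profiles) :
    ∃ y ∈ G.profiles, ∀ᵐ θ, ‖y θ - P.lift x θ‖ ≤ δ := by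
  obtain ⟨y, hym, hy⟩ :=
    (nullMeasurableCorr_of_measurableSet_graph (μ := volume) hact.graph).exists_aemeasurable_nearest
      (.of_forall fun θ => (hact.compact θ).isClosed) (.of_forall hact.convex)
      (.of_forall hact.nonempty) (P.memLp_lift x 2).1.aemeasurable
  refine ⟨y, ⟨.of_bound hym.aestronglyMeasurable M (hy.mono fun _ h => hact.norm_le h.1),
    hy.mono fun _ h => h.1⟩, ?_⟩
  filter_upwards [hy, infEDist_lift_le h hx] with θ hyθ hδθ
  rwa [← hyθ.2, edist_comm, edist_dist, ENNReal.ofReal_le_ofReal_iff hδ, dist_eq_norm] at hδθ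

theorem norm_lift_le_of_profile (hact : G.RegularActions M) (hδ : 0 ≤ δ)
    (h : actionGap G F P ≤ ENNReal.ofReal δ) {x : Fin F.n → Act T} (hx : x ∈ F.profiles) :
    ∀ᵐ θ, ‖P.lift x θ‖ ≤ M + δ := by
  obtain ⟨y, hy, hyx⟩ := exists_profile_near_lift hact hδ h hx
  filter_upwards [hy.2, hyx] with θ hyθ hyxθ
  exact (norm_le_norm_add_norm_sub _ _).trans (add_le_add (hact.norm_le hyθ) hyxθ)

theorem lift_mem_cube (hact : G.RegularActions M) (hF : F.RegularActions) (hδ : 0 ≤ δ)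
    (hδ1 : δ ≤ 1) (h : actionGap G F P ≤ ENNReal.ofReal δ) {x : Fin F.n → Act T}
    (hx : x ∈ F.profiles) : P.lift x ∈ L2 (cube T M) := by
  refine ⟨P.memLp_lift x 2, ?_⟩
  filter_upwards [P.ae_mem_cell, norm_lift_le_of_profile hact hδ h hx] with θ ⟨i, hi⟩ hθ
  refine mem_cube_of_norm_le (fun t => ?_) (hθ.trans (by linarith))
  rw [P.lift_apply x hi]
  exact mul_nonneg (inv_nonneg.2 (P.weight_pos i).le) (hF.nonneg i _ (hx i) t)

theorem setAverage_mem_cthickening (hact : F.RegularActions)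
    (h : actionGap G F P ≤ ENNReal.ofReal δ) {x : I → Act T} (hx : x ∈ G.profiles)
    (i : Fin F.n) :
    (⨍ θ in P.cell i, x θ) ∈ Metric.cthickening δ ((P.weight i)⁻¹ • F.act i) := by
  refine (((hact.convex i).smul _).cthickening δ).set_average_mem Metric.isClosed_cthickening
    (P.pos i).ne' (measure_ne_top _ _) ((ae_restrict_iff'₀ (P.measurable i)).2 ?_)
    (hx.1.integrable one_le_two).integrableOn
  filter_upwards [hx.2] with θ hθ hi
  exact (Metric.infEDist_le_hausdorffEDist_of_mem hθ).trans
    ((hausdorffEDist_act_le_actionGap hi).trans h)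

theorem exists_finite_profile_near (hact : F.RegularActions) (hδ : 0 ≤ δ)
    (h : actionGap G F P ≤ ENNReal.ofReal δ) {x : I → Act T} (hx : x ∈ G.profiles) :
    ∃ y ∈ F.profiles, ∀ i, ‖y i - ∫ θ in P.cell i, x θ‖ ≤ P.weight i * δ := by
  have hex : ∀ i, ∃ y ∈ F.act i, ‖y - ∫ θ in P.cell i, x θ‖ ≤ P.weight i * δ := fun i => by
    have hw := P.weight_pos i
    obtain ⟨_, ⟨y, hy, rfl⟩, hdist⟩ :=
      ((hact.compact i).smul (P.weight i)⁻¹).exists_infEDist_eq_edist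
        (hact.nonempty i).smul_set (⨍ θ in P.cell i, x θ)
    have hle := setAverage_mem_cthickening hact h hx i
    rw [Metric.mem_cthickening_iff, hdist, edist_dist, ENNReal.ofReal_le_ofReal_iff hδ,
      dist_comm, dist_eq_norm] at hle
    refine ⟨y, hy, ?_⟩
    have hrescale : y - ∫ θ in P.cell i, x θ =
        P.weight i • ((P.weight i)⁻¹ • y - ⨍ θ in P.cell i, x θ) := by
      rw [smul_sub, smul_inv_smul₀ hw.ne', setAverage_eq]
      exact congrArg _ (smul_inv_smul₀ hw.ne' _).symm
    rw [hrescale, norm_smul, Real.norm_of_nonneg hw.le]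
    gcongr
  choose y hy hyx using hex
  exact ⟨y, hy, hyx⟩

end ProfileApproximation

section Stability

variable {T : ℕ} {M B δ d c : ℝ} {G : NonatomicGame T} {F : FiniteGame T}
  {P : PlayerPartition F.n}

namespace NonatomicGame.RegularCosts

variable (hcost : G.RegularCosts M B)
include hcost

theorem ae_norm_le {x g : I → Act T} (hx : ∀ᵐ θ, x θ ∈ cube T M) {Y : Act T}
    (hY : Y ∈ cube T M) (hg : ∀ᵐ θ, g θ ∈ G.subgrad θ (x θ) Y) : ∀ᵐ θ, ‖g θ‖ ≤ B := by
  filter_upwards [hx, hg] with θ hxθ hgθ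
  exact hcost.subgrad_bound θ _ hxθ _ hY _ hgθ

theorem ae_norm_le_of_mem_H {x g : I → Act T} (hx : x ∈ L2 (cube T M)) (hg : g ∈ G.H x) :
    ∀ᵐ θ, ‖g θ‖ ≤ B :=
  hcost.ae_norm_le hx.2 (integral_mem_cube hx) hg.2

theorem nullMeasurableCorr_subgrad {x Y : Act T} (hx : x ∈ cube T M) (hY : Y ∈ cube T M) :
    NullMeasurableCorr (fun θ => G.subgrad θ x Y) volume :=
  nullMeasurableCorr_subdiff (subset_of_mem_nhdsSet hcost.dom_nhds hx)
    (hcost.measurable Y hY) (hcost.continuous Y hY)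

theorem nullMeasurableCorr_subgrad_lift {x : Fin F.n → Act T} {Y : Act T}
    (hx : ∀ᵐ θ, P.lift x θ ∈ cube T M) (hY : Y ∈ cube T M) :
    NullMeasurableCorr (fun θ => G.subgrad θ (P.lift x θ) Y) volume :=
  .of_cover P.measurable P.ae_mem_cell
    (fun i => hcost.nullMeasurableCorr_subgrad (P.inv_weight_smul_mem_of_ae_lift_mem hx i) hY)
    fun i θ hi => by rw [P.lift_apply x hi]

end NonatomicGame.RegularCosts

theorem infEDist_step_subgrad_le (hsub : subgradGap M G F P ≤ ENNReal.ofReal d)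
    {x γ : Fin F.n → Act T} (hx : ∀ᵐ θ, P.lift x θ ∈ cube T M) {Y : Act T} (hY : Y ∈ cube T M)
    (hγ : ∀ i, γ i ∈ F.subgrad i (x i) Y) :
    ∀ᵐ θ, Metric.infEDist (P.step γ θ) (G.subgrad θ (P.lift x θ) Y) ≤ ENNReal.ofReal d := by
  filter_upwards [P.ae_mem_cell, hx] with θ ⟨i, hi⟩ hxθ
  have hγi : γ i ∈ F.subgrad i (P.weight i • P.lift x θ) Y := by
    rw [P.lift_apply x hi, smul_inv_smul₀ (P.weight_pos i).ne']
    exact hγ i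
  rw [P.step_apply γ hi]
  exact (Metric.infEDist_le_hausdorffEDist_of_mem hγi).trans
    ((hausdorffEDist_subgrad_le_subgradGap hi hxθ hY).trans hsub)

theorem exists_mem_H_near_step (hcost : G.RegularCosts M B) (hd : 0 ≤ d)
    (hsub : subgradGap M G F P ≤ ENNReal.ofReal d) {x γ : Fin F.n → Act T}
    (hx : P.lift x ∈ L2 (cube T M)) (hγ : ∀ i, γ i ∈ F.subgrad i (x i) (∑ j, x j)) :
    ∃ h ∈ G.H (P.lift x), ∀ᵐ θ, ‖h θ - P.step γ θ‖ ≤ d := by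
  have hY : ∑ j, x j ∈ cube T M := P.integral_lift x ▸ integral_mem_cube hx
  have hdist := infEDist_step_subgrad_le hsub hx.2 hY hγ
  obtain ⟨h, hm, hh⟩ :=
    (hcost.nullMeasurableCorr_subgrad_lift hx.2 hY).exists_aemeasurable_nearest
      (.of_forall fun _ => isClosed_subdiff) (.of_forall fun _ => convex_subdiff)
      (hdist.mono fun θ hθ =>
        (Metric.infEDist_lt_iff.1 (hθ.trans_lt ENNReal.ofReal_lt_top)).imp fun _ h => h.1)
      (P.memLp_step γ 2).1.aemeasurable
  have hmem := hh.mono fun _ h => h.1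
  refine ⟨h, ⟨.of_bound hm.aestronglyMeasurable B (hcost.ae_norm_le hx.2 hY hmem), ?_⟩, ?_⟩
  · rwa [P.integral_lift]
  · filter_upwards [hh, hdist] with θ hhθ hdθ
    rwa [← hhθ.2, edist_comm, edist_dist, ENNReal.ofReal_le_ofReal_iff hd, dist_eq_norm] at hdθ

section VariationalInequality

variable {Ω E : Type*} [MeasurableSpace Ω] {μ : Measure Ω} [NormedAddCommGroup E]
  [InnerProductSpace ℝ E] {g h k x y z : Ω → E}

theorem integral_inner_sub_le_of_near [IsProbabilityMeasure μ] (hg : MemLp g 2 μ)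
    (hx : MemLp x 2 μ) (hy : MemLp y 2 μ) (hz : MemLp z 2 μ)
    (hVI : 0 ≤ ∫ ω, ⟪g ω, y ω - x ω⟫ ∂μ) (hgB : ∀ᵐ ω ∂μ, ‖g ω‖ ≤ B)
    (hyz : ∀ᵐ ω ∂μ, ‖y ω - z ω‖ ≤ c) : ∫ ω, ⟪g ω, x ω - z ω⟫ ∂μ ≤ B * c := calc
  ∫ ω, ⟪g ω, x ω - z ω⟫ ∂μ ≤ (∫ ω, ⟪g ω, y ω - x ω⟫ ∂μ) + ∫ ω, ⟪g ω, x ω - z ω⟫ ∂μ :=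
    le_add_of_nonneg_left hVI
  _ = ∫ ω, ⟪g ω, y ω - z ω⟫ ∂μ := by
    have hadd := integral_add (integrable_inner_of_memLp_two hg (hy.sub hx))
      (integrable_inner_of_memLp_two hg (hx.sub hz))
    simpa only [Pi.sub_apply, ← inner_add_right, sub_add_sub_cancel] using hadd.symm
  _ ≤ B * c := integral_inner_le_mul hgB hyz

theorem integral_inner_sub_sub_eq (hg : MemLp g 2 μ) (hh : MemLp h 2 μ) (hk : MemLp k 2 μ)
    (hx : MemLp x 2 μ) (hy : MemLp y 2 μ) :
    ∫ ω, ⟪h ω - g ω, x ω - y ω⟫ ∂μ = (∫ ω, ⟪g ω, y ω - x ω⟫ ∂μ) + (∫ ω, ⟪k ω, x ω - y ω⟫ ∂μ) +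
      ∫ ω, ⟪h ω - k ω, x ω - y ω⟫ ∂μ := by
  have hint_g := integrable_inner_of_memLp_two hg (hy.sub hx)
  have hint_k := integrable_inner_of_memLp_two hk (hx.sub hy)
  have hadd := integral_add (hint_g.add hint_k)
    (integrable_inner_of_memLp_two (hh.sub hk) (hx.sub hy))
  rw [integral_add' hint_g hint_k] at hadd
  refine Eq.trans (integral_congr_ae (.of_forall fun ω => ?_)) hadd
  simp only [Pi.add_apply, Pi.sub_apply, inner_sub_left, inner_sub_right]
  ring

end VariationalInequality

theorem PlayerPartition.sum_inner_sub_le_of_near {n : ℕ} (P : PlayerPartition n) {E : Type*}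
    [NormedAddCommGroup E] [InnerProductSpace ℝ E] {γ x y z : Fin n → E}
    (hVI : 0 ≤ ∑ i, ⟪γ i, y i - x i⟫) (hγ : ∀ i, ‖γ i‖ ≤ B)
    (hyz : ∀ i, ‖y i - z i‖ ≤ P.weight i * c) : ∑ i, ⟪γ i, x i - z i⟫ ≤ B * c := calc
  ∑ i, ⟪γ i, x i - z i⟫ ≤ ∑ i, ⟪γ i, y i - x i⟫ + ∑ i, ⟪γ i, x i - z i⟫ :=
    le_add_of_nonneg_left hVI
  _ = ∑ i, ⟪γ i, y i - z i⟫ := by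
    simp only [← Finset.sum_add_distrib, ← inner_add_right, sub_add_sub_cancel]
  _ ≤ B * c := P.sum_inner_le_mul hγ hyz

/-- Each equilibrium satisfies the variational inequality of its game at a profile close to the
other equilibrium, hence almost satisfies it at the other equilibrium itself. -/
theorem exists_mem_H_integral_inner_le (hact : G.RegularActions M) (hcost : G.RegularCosts M B)
    (hF : F.RegularActions) (hδ : 0 ≤ δ) (hδ1 : δ ≤ 1) (hd : 0 ≤ d)
    (hgap : actionGap G F P ≤ ENNReal.ofReal δ) (hsub : subgradGap M G F P ≤ ENNReal.ofReal d)
    {xs g y : I → Act T} (hxs : xs ∈ G.profiles) (hg : g ∈ G.H xs) (hy : y ∈ G.profiles)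
    (hW : 0 ≤ ∫ θ, ⟪g θ, y θ - xs θ⟫) {xh γ z : Fin F.n → Act T} (hxh : xh ∈ F.profiles)
    (hγ : ∀ i, γ i ∈ F.subgrad i (xh i) (∑ j, xh j)) (hN : 0 ≤ ∑ i, ⟪γ i, z i - xh i⟫)
    (hyc : ∀ᵐ θ, ‖y θ - P.lift xh θ‖ ≤ c)
    (hzc : ∀ i, ‖z i - ∫ θ in P.cell i, xs θ‖ ≤ P.weight i * c) :
    ∃ h ∈ G.H (P.lift xh),
      ∫ θ, ⟪h θ - g θ, P.lift xh θ - xs θ⟫ ≤ B * c + (B + d) * c + d * (2 * M + δ) := by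
  have hψ := lift_mem_cube hact hF hδ hδ1 hgap hxh
  obtain ⟨h, hh, hhγ⟩ := exists_mem_H_near_step hcost hd hsub hψ hγ
  have hdiff : MemLp (fun θ => P.lift xh θ - xs θ) 2 := hψ.1.sub hxs.1
  have hγB : ∀ i, ‖γ i‖ ≤ B + d := fun i => by
    obtain ⟨θ, hi, hhθ, hhγθ⟩ :=
      P.exists_mem_cell_of_ae ((hcost.ae_norm_le_of_mem_H hψ hh).and hhγ) i
    rw [P.step_apply γ hi] at hhγθ
    exact (norm_le_norm_add_norm_sub _ _).trans (add_le_add hhθ hhγθ)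
  have hWardrop : ∫ θ, ⟪g θ, xs θ - P.lift xh θ⟫ ≤ B * c :=
    integral_inner_sub_le_of_near hg.1 hxs.1 hy.1 hψ.1 hW
      (hcost.ae_norm_le_of_mem_H (hact.profiles_subset_L2 hxs) hg) hyc
  have hNash : ∫ θ, ⟪P.step γ θ, P.lift xh θ - xs θ⟫ ≤ (B + d) * c := by
    rw [P.integral_inner_step γ (hdiff.integrable one_le_two)]
    simp only [integral_sub (hψ.1.integrable one_le_two).integrableOn
      (hxs.1.integrable one_le_two).integrableOn, P.setIntegral_lift]
    exact P.sum_inner_sub_le_of_near hN hγB hzc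
  have hsubst : ∫ θ, ⟪h θ - P.step γ θ, P.lift xh θ - xs θ⟫ ≤ d * (2 * M + δ) := by
    refine integral_inner_le_mul hhγ ?_
    filter_upwards [norm_lift_le_of_profile hact hδ hgap hxh, hxs.2] with θ hψθ hxsθ
    linarith [norm_sub_le (P.lift xh θ) (xs θ), hact.norm_le hxsθ]
  refine ⟨h, hh, ?_⟩
  rw [integral_inner_sub_sub_eq hg.1 hh.1 (P.memLp_step γ 2) hψ.1 hxs.1]
  exact add_le_add_three hWardrop hNash hsubst

end Stability

theorem inter_frontier_nonempty_of_isPreconnected {α : Type*} [TopologicalSpace α] {s t : Set α}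
    (hs : IsPreconnected s) (ht : (s ∩ t).Nonempty) (htc : (s ∩ tᶜ).Nonempty) :
    (s ∩ frontier t).Nonempty := by
  by_contra hne
  rw [Set.not_nonempty_iff_eq_empty, ← Set.disjoint_iff_inter_eq_empty, Set.disjoint_left] at hne
  have hint : ∀ x ∈ s, x ∈ t → x ∈ interior t := fun x hx hxt =>
    by_contra fun h => hne hx ⟨subset_closure hxt, h⟩
  have hext : ∀ x ∈ s, x ∉ t → x ∈ (closure t)ᶜ := fun x hx hxt h =>
    hne hx ⟨h, fun h' => hxt (interior_subset h')⟩
  obtain ⟨a, ha, hat⟩ := ht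
  obtain ⟨b, hb, hbt⟩ := htc
  obtain ⟨q, -, hq, hq'⟩ := hs (interior t) (closure t)ᶜ isOpen_interior
    isClosed_closure.isOpen_compl
    (fun x hx => (em (x ∈ t)).imp (hint x hx) (hext x hx)) ⟨a, ha, hint a ha hat⟩
    ⟨b, hb, hext b hb hbt⟩
  exact hq' (subset_closure (interior_subset hq))

section Normed

variable {E : Type*} [NormedAddCommGroup E] [NormedSpace ℝ E]

theorem exists_bounded_decomposition (V W : Submodule ℝ E) [FiniteDimensional ℝ V]
    [FiniteDimensional ℝ W] :
    ∃ C > 0, ∀ u ∈ V ⊔ W, ∃ v ∈ V, ∃ w ∈ W, v + w = u ∧ ‖v‖ ≤ C * ‖u‖ ∧ ‖w‖ ≤ C * ‖u‖ := by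
  let L : V × W →ₗ[ℝ] (V ⊔ W : Submodule ℝ E) :=
    (Submodule.inclusion le_sup_left).coprod (Submodule.inclusion le_sup_right)
  have hL : Function.Surjective L.toContinuousLinearMap := by
    rintro ⟨u, hu⟩
    obtain ⟨v, hv, w, hw, rfl⟩ := Submodule.mem_sup.1 hu
    exact ⟨(⟨v, hv⟩, ⟨w, hw⟩), rfl⟩
  obtain ⟨C, hC, hpre⟩ := L.toContinuousLinearMap.exists_preimage_norm_le hL
  refine ⟨C, hC, fun u hu => ?_⟩
  obtain ⟨⟨v, w⟩, hvw, hnorm⟩ := hpre ⟨u, hu⟩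
  exact ⟨v, v.2, w, w.2, congrArg Subtype.val hvw, (norm_fst_le (v, w)).trans hnorm,
    (norm_snd_le (v, w)).trans hnorm⟩

theorem exists_forall_add_mem_of_mem_intrinsicInterior {A : Set E} {z : E}
    (hz : z ∈ intrinsicInterior ℝ A) :
    ∃ r > 0, ∀ v ∈ vectorSpan ℝ A, ‖v‖ ≤ r → z + v ∈ A := by
  obtain ⟨y, hy, rfl⟩ := mem_intrinsicInterior.1 hz
  obtain ⟨r, hr, hball⟩ := Metric.nhds_basis_closedBall.mem_iff.1 (mem_interior_iff_mem_nhds.1 hy)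
  refine ⟨r, hr, fun v hv hvr => ?_⟩
  have hmem : (y : E) + v ∈ affineSpan ℝ A := by
    rw [add_comm, ← vadd_eq_add]
    exact AffineSubspace.vadd_mem_of_mem_direction (by rwa [direction_affineSpan]) y.2
  have hdist : (⟨(y : E) + v, hmem⟩ : affineSpan ℝ A) ∈ Metric.closedBall y r := by
    rwa [Metric.mem_closedBall, Subtype.dist_eq, dist_eq_norm, add_sub_cancel_left]
  exact hball hdist

theorem span_sub_le_sup_vectorSpan {A C : Set E} {z : E} (hA : z ∈ A) (hC : z ∈ C) :
    Submodule.span ℝ (A - C) ≤ vectorSpan ℝ A ⊔ vectorSpan ℝ C := by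
  refine Submodule.span_le.2 ?_
  rintro _ ⟨a, ha, c, hc, rfl⟩
  change a - c ∈ vectorSpan ℝ A ⊔ vectorSpan ℝ C
  rw [← sub_sub_sub_cancel_right a c z]
  exact Submodule.sub_mem _ (Submodule.mem_sup_left (vsub_mem_vectorSpan ℝ ha hA))
    (Submodule.mem_sup_right (vsub_mem_vectorSpan ℝ hc hC))

theorem exists_span_inter_closedBall_subset_sub [FiniteDimensional ℝ E] {A C : Set E}
    (h : (intrinsicInterior ℝ A ∩ intrinsicInterior ℝ C).Nonempty) :
    ∃ r > 0, (Submodule.span ℝ (A - C) : Set E) ∩ Metric.closedBall 0 r ⊆ A - C := by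
  obtain ⟨z, hzA, hzC⟩ := h
  obtain ⟨rA, hrA, hballA⟩ := exists_forall_add_mem_of_mem_intrinsicInterior hzA
  obtain ⟨rC, hrC, hballC⟩ := exists_forall_add_mem_of_mem_intrinsicInterior hzC
  obtain ⟨K, hK, hdec⟩ := exists_bounded_decomposition (vectorSpan ℝ A) (vectorSpan ℝ C)
  refine ⟨min rA rC / K, by positivity, fun u ⟨hu, hur⟩ => ?_⟩
  rw [mem_closedBall_zero_iff, le_div_iff₀' hK] at hur
  obtain ⟨v, hv, w, hw, hvw, hvn, hwn⟩ := hdec u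
    (span_sub_le_sup_vectorSpan (intrinsicInterior_subset hzA) (intrinsicInterior_subset hzC) hu)
  refine ⟨z + v, hballA v hv (hvn.trans (hur.trans (min_le_left _ _))), z + -w,
    hballC (-w) (Submodule.neg_mem _ hw) ?_, ?_⟩
  · rw [norm_neg]
    exact hwn.trans (hur.trans (min_le_right _ _))
  · rw [← hvw]
    exact (add_sub_add_left_eq_sub _ _ _).trans (sub_neg_eq_add v w)

/-- With `t = ε / (ε + r)`, the scaled error `(1 - t) • (Y - p)` is `t • (a - s)` for some `a ∈ A`
and `s ∈ C`. -/
theorem exists_convex_combination_mem {A C : Set E} {U : Submodule ℝ E} (hA : Convex ℝ A) {r ε : ℝ}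
    (hr : 0 < r) (hball : (U : Set E) ∩ Metric.closedBall 0 r ⊆ A - C) {Y p : E} (hp : p ∈ A)
    (hU : Y - p ∈ U) (hε : ‖Y - p‖ ≤ ε) :
    ∃ t : ℝ, 0 ≤ t ∧ t ≤ 1 ∧ t ≤ ε / r ∧ ∃ s ∈ C, (1 - t) • Y + t • s ∈ A := by
  rcases ((norm_nonneg _).trans hε).eq_or_lt with rfl | hε0
  · obtain ⟨a, -, s, hs, -⟩ := hball ⟨U.zero_mem, by simpa using hr.le⟩
    have hY : Y = p := sub_eq_zero.1 (norm_le_zero_iff.1 hε)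
    exact ⟨0, le_rfl, zero_le_one, by simp, s, hs, by simpa [hY] using hp⟩
  obtain ⟨a, ha, s, hs, has⟩ : (r / ε) • (Y - p) ∈ A - C := by
    refine hball ⟨U.smul_mem _ hU, ?_⟩
    rw [mem_closedBall_zero_iff, norm_smul, Real.norm_of_nonneg (by positivity)]
    calc r / ε * ‖Y - p‖ ≤ r / ε * ε := by gcongr
      _ = r := div_mul_cancel₀ r hε0.ne'
  set t := ε / (ε + r) with ht
  have ht0 : 0 ≤ t := by positivity
  have ht1 : t ≤ 1 := div_le_one_of_le₀ (by linarith) (by positivity)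
  refine ⟨t, ht0, ht1, div_le_div_of_nonneg_left hε0.le hr (by linarith), s, hs, ?_⟩
  have hscale : t • (a - s) = (1 - t) • (Y - p) := by
    have htr : t * (r / ε) = 1 - t := by
      rw [ht]
      field_simp
      ring
    rw [← htr, mul_smul, ← has]
  have hcomb : (1 - t) • Y + t • s = (1 - t) • p + t • a :=
    calc (1 - t) • Y + t • s = (1 - t) • p + t • a + ((1 - t) • (Y - p) - t • (a - s)) := by module
      _ = (1 - t) • p + t • a := by rw [hscale, sub_self, add_zero]
  rw [hcomb]
  exact hA hp ha (by linarith) ht0 (by ring)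

end Normed

/-- Otherwise `K'` lies in a half-space bounded by the hyperplane through the projection `p` of `u`
to `K'`, and the point of `K` farthest in the direction `u - p` is too far from `K'`. -/
theorem inter_closedBall_subset_of_near {E : Type*} [NormedAddCommGroup E] [InnerProductSpace ℝ E]
    {K K' : Set E} {U : Submodule ℝ E} (hc : Convex ℝ K') (hK' : IsComplete K') (hU : K' ⊆ U)
    {r ε : ℝ} (hr : 0 < r) (hball : (U : Set E) ∩ Metric.closedBall 0 r ⊆ K)
    (hnear : ∀ k ∈ K, ∃ k' ∈ K', ‖k - k'‖ ≤ ε) :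
    (U : Set E) ∩ Metric.closedBall 0 (r - ε) ⊆ K' := by
  rintro u ⟨hu, hur⟩
  rw [mem_closedBall_zero_iff] at hur
  obtain ⟨k₀, hk₀, -⟩ := hnear 0 (hball ⟨U.zero_mem, by simpa using hr.le⟩)
  obtain ⟨p, hp, hpmin⟩ := exists_norm_eq_iInf_of_complete_convex ⟨k₀, hk₀⟩ hK' hc u
  rw [norm_eq_iInf_iff_real_inner_le_zero hc hp] at hpmin
  by_contra huK
  have hn : 0 < ‖u - p‖ := norm_pos_iff.2 fun h => huK (sub_eq_zero.1 h ▸ hp)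
  set k := (r / ‖u - p‖) • (u - p) with hk
  have hkK : k ∈ K := by
    refine hball ⟨U.smul_mem _ (U.sub_mem hu (hU hp)), ?_⟩
    rw [mem_closedBall_zero_iff, norm_smul, Real.norm_of_nonneg (by positivity),
      div_mul_cancel₀ _ hn.ne']
  obtain ⟨k', hk', hkk'⟩ := hnear k hkK
  have hsupp : ⟪u - p, k' - p⟫ ≤ 0 := hpmin k' hk'
  have hsplit : ⟪u - p, k' - p⟫ =
      ⟪u - p, k⟫ - ⟪u - p, k - k'⟫ - ⟪u - p, u⟫ + ⟪u - p, u - p⟫ := by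
    simp only [inner_sub_right]
    ring
  have hfar : ⟪u - p, k⟫ = r * ‖u - p‖ := by
    rw [hk, real_inner_smul_right, real_inner_self_eq_norm_sq]
    field_simp
  have hkk'_inner : ⟪u - p, k - k'⟫ ≤ ‖u - p‖ * ε :=
    (real_inner_le_norm _ _).trans (mul_le_mul_of_nonneg_left hkk' hn.le)
  have hu_inner : ⟪u - p, u⟫ ≤ ‖u - p‖ * (r - ε) :=
    (real_inner_le_norm _ _).trans (mul_le_mul_of_nonneg_left hur hn.le)
  rw [real_inner_self_eq_norm_sq] at hsplit
  nlinarith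

theorem add_mem_of_lt_infEDist_relBoundary {T : ℕ} {C : Set (Act T)} {x w : Act T} {η : ℝ}
    (hη : 0 ≤ η) (hx : x ∈ C) (hd : ENNReal.ofReal η < Metric.infEDist x (relBoundary C))
    (hw : w ∈ Submodule.span ℝ C) (hwη : ‖w‖ ≤ η) : x + w ∈ C := by
  by_contra hxw
  let a : Submodule.span ℝ C := ⟨x, Submodule.subset_span hx⟩
  let b : Submodule.span ℝ C := a + ⟨w, hw⟩
  obtain ⟨q, hq, hqC⟩ := inter_frontier_nonempty_of_isPreconnected
    (convex_segment a b).isPreconnected (t := ((↑) : Submodule.span ℝ C → Act T) ⁻¹' C)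
    ⟨a, left_mem_segment ℝ a b, hx⟩ ⟨b, right_mem_segment ℝ a b, hxw⟩
  have hfar : η < dist x q := by
    have hedist := hd.trans_le (Metric.infEDist_le_edist_of_mem (Set.mem_image_of_mem _ hqC))
    rwa [edist_dist, ENNReal.ofReal_lt_ofReal_iff_of_nonneg hη] at hedist
  have hnear : dist x q ≤ η :=
    calc dist x q = dist q a := dist_comm _ _
      _ ≤ dist a b := segment_subset_closedBall_left a b hq
      _ = ‖w‖ := by simp [b, dist_eq_norm]
      _ ≤ η := hwη
  exact hfar.not_ge hnear

theorem exists_norm_sub_le_of_infEDist_le {E : Type*} [SeminormedAddCommGroup E] {S : Set E}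
    (hS : IsCompact S) {x : E} {e : ℝ} (he : 0 ≤ e)
    (h : Metric.infEDist x S ≤ ENNReal.ofReal e) : ∃ y ∈ S, ‖x - y‖ ≤ e := by
  obtain ⟨y, hy, hxy⟩ := hS.exists_infEDist_eq_edist
    ((Metric.infEDist_lt_iff.1 (h.trans_lt ENNReal.ofReal_lt_top)).imp fun _ h => h.1) x
  rw [hxy, edist_dist, ENNReal.ofReal_le_ofReal_iff he, dist_eq_norm] at h
  exact ⟨y, hy, h⟩

section ConstrainedApproximation

variable {T : ℕ} {M e r : ℝ} {G : NonatomicGame T} {F : FiniteGame T} {P : PlayerPartition F.n}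
  {A A' : Set (Act T)}

theorem NonatomicGame.RegularActions.convex_profiles (hact : G.RegularActions M) :
    Convex ℝ G.profiles := fun x hx y hy a b ha hb hab => by
  refine ⟨(hx.1.const_smul a).add (hy.1.const_smul b), ?_⟩
  filter_upwards [hx.2, hy.2] with θ hxθ hyθ
  exact hact.convex θ hxθ hyθ ha hb hab

namespace FiniteGame.RegularActions

variable (hF : F.RegularActions)
include hF

theorem convex_profiles : Convex ℝ F.profiles :=
  fun _ hx _ hy _ _ ha hb hab i => hF.convex i (hx i) (hy i) ha hb hab

theorem convex_aggregates : Convex ℝ F.aggregates := by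
  rintro _ ⟨x, hx, rfl⟩ _ ⟨y, hy, rfl⟩ a b ha hb hab
  refine ⟨a • x + b • y, hF.convex_profiles hx hy ha hb hab, ?_⟩
  simp [Finset.sum_add_distrib, Finset.smul_sum]

theorem isCompact_aggregates : IsCompact F.aggregates := by
  have himage : F.aggregates = (fun x : Fin F.n → Act T => ∑ i, x i) '' Set.univ.pi F.act := by
    ext Y
    simp [FiniteGame.aggregates, FiniteGame.profiles, Set.mem_pi]
  rw [himage]
  exact (isCompact_univ_pi hF.compact).image (by fun_prop)

end FiniteGame.RegularActions

/-- A profile in the uniform interior can be moved by a small multiple of `f`. -/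
theorem NonatomicGame.UniformInterior.integral_mem_vectorSpan (hI : G.UniformInterior)
    {f : I → Act T} (hf : MemLp f ∞ volume) (hspan : ∀ᵐ θ, f θ ∈ Submodule.span ℝ (G.act θ)) :
    ∫ θ, f θ ∈ vectorSpan ℝ G.aggregates := by
  obtain ⟨η, hη, x, hx, hxη⟩ := hI
  obtain ⟨C, hC, hfC⟩ : ∃ C > 0, ∀ᵐ θ, ‖f θ‖ ≤ C := by
    refine ⟨(eLpNormEssSup f volume).toReal + 1, by positivity, ?_⟩
    filter_upwards [ae_le_eLpNormEssSup (f := f) (μ := volume)] with θ hθ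
    rw [← toReal_enorm]
    exact (ENNReal.toReal_mono (eLpNorm_exponent_top (f := f) ▸ hf.eLpNorm_ne_top) hθ).trans
      (by linarith)
  have hτ : 0 < η / C := by positivity
  have hf2 : MemLp f 2 volume := hf.mono_exponent le_top
  have hmem : x + (η / C) • f ∈ G.profiles := by
    refine ⟨hx.1.add (hf2.const_smul _), ?_⟩
    filter_upwards [hx.2, hxη, hfC, hspan] with θ hxθ hηθ hfθ hspanθ
    refine add_mem_of_lt_infEDist_relBoundary hη.le hxθ hηθ (Submodule.smul_mem _ _ hspanθ) ?_
    rw [Pi.smul_apply, norm_smul, Real.norm_of_nonneg hτ.le]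
    calc η / C * ‖f θ‖ ≤ η / C * C := by gcongr
      _ = η := div_mul_cancel₀ η hC.ne'
  have hmove : (∫ θ, (x + (η / C) • f) θ) - ∫ θ, x θ = (η / C) • ∫ θ, f θ := by
    rw [← integral_sub (hmem.1.integrable one_le_two) (hx.1.integrable one_le_two), ← integral_smul]
    simp
  rw [← inv_smul_smul₀ hτ.ne' (∫ θ, f θ), ← hmove]
  exact Submodule.smul_mem _ _ (vsub_mem_vectorSpan ℝ ⟨_, hmem, rfl⟩ ⟨x, hx, rfl⟩)

theorem aggregates_subset_vectorSpan (hact : G.RegularActions M) (hI : G.UniformInterior) :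
    G.aggregates ⊆ vectorSpan ℝ G.aggregates := by
  rintro _ ⟨x, hx, rfl⟩
  exact hI.integral_mem_vectorSpan
    (.of_bound hx.1.1 M (hx.2.mono fun θ h => hact.norm_le h))
    (hx.2.mono fun θ h => Submodule.subset_span h)

theorem finite_aggregates_subset_vectorSpan (hI : G.UniformInterior)
    (hspan : ∀ i, ∀ θ ∈ P.cell i, Submodule.span ℝ (F.act i) = Submodule.span ℝ (G.act θ)) :
    F.aggregates ⊆ vectorSpan ℝ G.aggregates := by
  rintro _ ⟨x, hx, rfl⟩
  rw [← P.integral_lift]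
  refine hI.integral_mem_vectorSpan (P.memLp_lift x ∞) ?_
  filter_upwards [P.ae_mem_cell] with θ ⟨i, hi⟩
  rw [P.lift_apply x hi, ← hspan i θ hi]
  exact Submodule.smul_mem _ _ (Submodule.subset_span (hx i))

theorem vectorSpan_le_span_sub {E : Type*} [AddCommGroup E] [Module ℝ E] {S C : Set E}
    (hS : S.Nonempty) : vectorSpan ℝ C ≤ Submodule.span ℝ (S - C) := by
  obtain ⟨a, ha⟩ := hS
  refine Submodule.span_le.2 ?_
  rintro _ ⟨c, hc, c', hc', rfl⟩
  change c - c' ∈ Submodule.span ℝ (S - C)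
  rw [← sub_sub_sub_cancel_left c' c a]
  exact Submodule.sub_mem _ (Submodule.subset_span (Set.sub_mem_sub ha hc'))
    (Submodule.subset_span (Set.sub_mem_sub ha hc))

theorem sub_aggregates_subset_span (hact : G.RegularActions M) (hI : G.UniformInterior)
    (hA : A.Nonempty)
    (hspan : ∀ i, ∀ θ ∈ P.cell i, Submodule.span ℝ (F.act i) = Submodule.span ℝ (G.act θ))
    (hspanA : Submodule.span ℝ A = Submodule.span ℝ A') :
    A' - F.aggregates ⊆ Submodule.span ℝ (A - G.aggregates) := by
  set U := Submodule.span ℝ (A - G.aggregates)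
  have hAU : Submodule.span ℝ A ≤ U := by
    refine Submodule.span_le.2 fun a ha => ?_
    obtain ⟨Y, hY⟩ : G.aggregates.Nonempty := hI.elim fun _ ⟨_, x, hx, _⟩ => ⟨_, x, hx, rfl⟩
    rw [SetLike.mem_coe, ← sub_add_cancel a Y]
    exact U.add_mem (Submodule.subset_span (Set.sub_mem_sub ha hY))
      (vectorSpan_le_span_sub hA (aggregates_subset_vectorSpan hact hI hY))
  rintro _ ⟨a, ha, Z, hZ, rfl⟩
  exact U.sub_mem (hAU (hspanA ▸ Submodule.subset_span ha))
    (vectorSpan_le_span_sub hA (finite_aggregates_subset_vectorSpan hI hspan hZ))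

theorem norm_add_smul_sub_le {E : Type*} [SeminormedAddCommGroup E] [NormedSpace ℝ E]
    {y q v : E} {t s c b : ℝ} (ht : 0 ≤ t) (hts : t ≤ s) (hyv : ‖y - v‖ ≤ c) (hy : ‖y‖ ≤ b)
    (hq : ‖q‖ ≤ b) : ‖(1 - t) • y + t • q - v‖ ≤ c + s * (2 * b) :=
  calc ‖(1 - t) • y + t • q - v‖ = ‖(y - v) + t • (q - y)‖ := by
        congr 1
        module
    _ ≤ ‖y - v‖ + ‖t • (q - y)‖ := norm_add_le _ _
    _ = ‖y - v‖ + t * ‖q - y‖ := by rw [norm_smul, Real.norm_of_nonneg ht]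
    _ ≤ c + s * (2 * b) := by
        gcongr
        · exact ht.trans hts
        · linarith [norm_sub_le q y]

theorem exists_constrProfile_near_lift (hact : G.RegularActions M) (hA : Convex ℝ A)
    (hAc : IsCompact A) (hr : 0 < r)
    (hball : (Submodule.span ℝ (A - G.aggregates) : Set (Act T)) ∩ Metric.closedBall 0 r ⊆
      A - G.aggregates)
    (he : 0 ≤ e) (hgap : actionGap G F P ≤ ENNReal.ofReal e)
    (hD : Metric.hausdorffEDist A' A ≤ ENNReal.ofReal e) {x : Fin F.n → Act T}
    (hx : x ∈ F.constrProfiles A') :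
    ∃ y ∈ G.constrProfiles A, ∀ᵐ θ, ‖y θ - P.lift x θ‖ ≤ e + 2 * e / r * (2 * M) := by
  obtain ⟨y, hy, hyx⟩ := exists_profile_near_lift hact he hgap hx.1
  obtain ⟨p, hp, hxp⟩ := exists_norm_sub_le_of_infEDist_le hAc he
    ((Metric.infEDist_le_hausdorffEDist_of_mem hx.2).trans hD)
  have hyi : Integrable y volume := hy.1.integrable one_le_two
  have hYp : ‖(∫ θ, y θ) - p‖ ≤ 2 * e := by
    have hYx := norm_integral_sub_le hyi ((P.memLp_lift x 1).integrable le_rfl) hyx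
    rw [P.integral_lift] at hYx
    linarith [norm_sub_le_norm_sub_add_norm_sub (∫ θ, y θ) (∑ i, x i) p]
  have hU : (∫ θ, y θ) - p ∈ Submodule.span ℝ (A - G.aggregates) :=
    sub_mem_comm_iff.1 (Submodule.subset_span (Set.sub_mem_sub hp ⟨y, hy, rfl⟩))
  obtain ⟨t, ht, ht', htr, _, ⟨q, hq, rfl⟩, hmem⟩ :=
    exists_convex_combination_mem hA hr hball hp hU hYp
  have hqi : Integrable q volume := hq.1.integrable one_le_two
  refine ⟨(1 - t) • y + t • q,
    ⟨hact.convex_profiles hy hq (sub_nonneg.2 ht') ht (sub_add_cancel 1 t), ?_⟩, ?_⟩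
  · rw [integral_add' (hyi.smul (1 - t)) (hqi.smul t)]
    simpa only [Pi.smul_apply, integral_smul] using hmem
  · filter_upwards [hyx, hy.2, hq.2] with θ hyxθ hyθ hqθ
    exact norm_add_smul_sub_le ht htr hyxθ (hact.norm_le hyθ) (hact.norm_le hqθ)

theorem norm_le_of_mem_profiles (hact : G.RegularActions M) (he : 0 ≤ e)
    (hgap : actionGap G F P ≤ ENNReal.ofReal e) {x : Fin F.n → Act T} (hx : x ∈ F.profiles)
    (i : Fin F.n) : ‖x i‖ ≤ P.weight i * (M + e) := by
  have hw := P.weight_pos i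
  have hscaled := P.inv_weight_smul_mem_of_ae_lift_mem (S := Metric.closedBall 0 (M + e))
    (by simpa using norm_lift_le_of_profile hact he hgap hx) i
  rwa [mem_closedBall_zero_iff, norm_smul, Real.norm_of_nonneg (by positivity),
    inv_mul_le_iff₀ hw] at hscaled

theorem span_inter_closedBall_subset_sub_aggregates (hF : F.RegularActions) (hA' : Convex ℝ A')
    (hAc' : IsCompact A') (hU : A' - F.aggregates ⊆ Submodule.span ℝ (A - G.aggregates))
    (hr : 0 < r)
    (hball : (Submodule.span ℝ (A - G.aggregates) : Set (Act T)) ∩ Metric.closedBall 0 r ⊆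
      A - G.aggregates)
    (he : 0 ≤ e) (hgap : actionGap G F P ≤ ENNReal.ofReal e)
    (hD : Metric.hausdorffEDist A' A ≤ ENNReal.ofReal e) :
    (Submodule.span ℝ (A - G.aggregates) : Set (Act T)) ∩ Metric.closedBall 0 (r - 2 * e) ⊆
      A' - F.aggregates := by
  have hcompact : IsCompact (A' - F.aggregates) := by
    rw [sub_eq_add_neg]
    exact hAc'.add hF.isCompact_aggregates.neg
  refine inter_closedBall_subset_of_near (hA'.sub hF.convex_aggregates) hcompact.isComplete hU hr
    hball ?_
  rintro _ ⟨a, ha, _, ⟨x, hx, rfl⟩, rfl⟩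
  rw [Metric.hausdorffEDist_comm] at hD
  obtain ⟨a', ha', haa'⟩ := exists_norm_sub_le_of_infEDist_le hAc' he
    ((Metric.infEDist_le_hausdorffEDist_of_mem ha).trans hD)
  obtain ⟨z, hz, hzx⟩ := exists_finite_profile_near hF he hgap hx
  have hZx := P.norm_sum_sub_integral_le (hx.1.integrable one_le_two) hzx
  refine ⟨a' - ∑ i, z i, Set.sub_mem_sub ha' ⟨z, hz, rfl⟩, ?_⟩
  calc ‖(a - ∫ θ, x θ) - (a' - ∑ i, z i)‖ = ‖(a - a') + (∑ i, z i - ∫ θ, x θ)‖ := by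
        congr 1
        abel
    _ ≤ ‖a - a'‖ + ‖∑ i, z i - ∫ θ, x θ‖ := norm_add_le _ _
    _ ≤ 2 * e := by linarith

theorem exists_finite_constrProfile_near (hact : G.RegularActions M) (hF : F.RegularActions)
    (hA' : Convex ℝ A') (hAc' : IsCompact A')
    (hU : A' - F.aggregates ⊆ Submodule.span ℝ (A - G.aggregates))
    (hball : (Submodule.span ℝ (A - G.aggregates) : Set (Act T)) ∩ Metric.closedBall 0 r ⊆
      A - G.aggregates)
    (he : 0 ≤ e) (her : 2 * e < r) (hgap : actionGap G F P ≤ ENNReal.ofReal e)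
    (hD : Metric.hausdorffEDist A' A ≤ ENNReal.ofReal e) {x : I → Act T}
    (hx : x ∈ G.constrProfiles A) :
    ∃ z ∈ F.constrProfiles A', ∀ i, ‖z i - ∫ θ in P.cell i, x θ‖ ≤
      P.weight i * (e + 2 * e / (r - 2 * e) * (2 * (M + e))) := by
  obtain ⟨z, hz, hzx⟩ := exists_finite_profile_near hF he hgap hx.1
  obtain ⟨p, hp, hxp⟩ := exists_norm_sub_le_of_infEDist_le hAc' he
    ((Metric.infEDist_le_hausdorffEDist_of_mem hx.2).trans
      (Metric.hausdorffEDist_comm.trans_le hD))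
  have hZp : ‖(∑ i, z i) - p‖ ≤ 2 * e := by
    have hZx := P.norm_sum_sub_integral_le (hx.1.1.integrable one_le_two) hzx
    linarith [norm_sub_le_norm_sub_add_norm_sub (∑ i, z i) (∫ θ, x θ) p]
  have hZU : (∑ i, z i) - p ∈ Submodule.span ℝ (A - G.aggregates) :=
    sub_mem_comm_iff.1 (hU (Set.sub_mem_sub hp ⟨z, hz, rfl⟩))
  obtain ⟨t, ht, ht', htr, _, ⟨q, hq, rfl⟩, hmem⟩ :=
    exists_convex_combination_mem hA' (sub_pos.2 her)
      (span_inter_closedBall_subset_sub_aggregates hF hA' hAc' hU (by linarith) hball he hgap hD)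
      hp hZU hZp
  refine ⟨(1 - t) • z + t • q,
    ⟨hF.convex_profiles hz hq (sub_nonneg.2 ht') ht (sub_add_cancel 1 t), ?_⟩, fun i => ?_⟩
  · simpa [Finset.sum_add_distrib, Finset.smul_sum] using hmem
  · refine (norm_add_smul_sub_le ht htr (hzx i) (norm_le_of_mem_profiles hact he hgap hz i)
      (norm_le_of_mem_profiles hact he hgap hq i)).trans_eq ?_
    ring

end ConstrainedApproximation

theorem eLpNorm_two_sq_eq_ofReal_integral {α E : Type*} [MeasurableSpace α]
    {μ : Measure α} [NormedAddCommGroup E] {f : α → E} (hf : MemLp f 2 μ) :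
    eLpNorm f 2 μ ^ 2 = ENNReal.ofReal (∫ a, ‖f a‖ ^ 2 ∂μ) := by
  have h0 : 0 ≤ ∫ a, ‖f a‖ ^ (2 : ℝ) ∂μ := integral_nonneg fun a => by positivity
  rw [hf.eLpNorm_eq_integral_rpow_norm two_ne_zero ENNReal.ofNat_ne_top,
    ← ENNReal.ofReal_pow (Real.rpow_nonneg (by simpa using h0) _), ENNReal.toReal_ofNat,
    ← Real.rpow_natCast, ← Real.rpow_mul h0]
  norm_num

theorem exists_eq_ofReal_of_two_mul_lt {u : ℝ≥0∞} {ρ : ℝ} (h : 2 * u < ENNReal.ofReal ρ) :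
    ∃ e : ℝ, 0 ≤ e ∧ u = ENNReal.ofReal e ∧ 2 * e < ρ := by
  have hu : u ≠ ∞ := by
    rintro rfl
    simp at h
  refine ⟨u.toReal, ENNReal.toReal_nonneg, (ENNReal.ofReal_toReal hu).symm, ?_⟩
  rw [← ENNReal.toReal_ofNat, ← ENNReal.toReal_mul]
  exact (ENNReal.lt_ofReal_iff_toReal_lt (by finiteness)).1 h

theorem tendsto_zero_of_pow_le {ι : Type*} {l : Filter ι} {u v : ι → ℝ≥0∞} {n : ℕ}
    (hn : n ≠ 0) (hv : Tendsto v l (𝓝 0)) (h : ∀ᶠ i in l, u i ^ n ≤ v i) :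
    Tendsto u l (𝓝 0) := by
  refine ENNReal.tendsto_nhds_zero.2 fun ε hε => ?_
  filter_upwards [h, ENNReal.tendsto_nhds_zero.1 hv (ε ^ n) (ENNReal.pow_pos hε n)] with i hi hvi
  exact (ENNReal.pow_le_pow_left_iff hn).1 (hi.trans hvi)

section ErrorTerm

variable {M B K m : ℝ}

theorem tendsto_errorTerm_zero {ι : Type*} {l : Filter ι} {D δ d : ι → ℝ≥0∞}
    (hD : Tendsto D l (𝓝 0)) (hδ : Tendsto δ l (𝓝 0)) (hd : Tendsto d l (𝓝 0)) :
    Tendsto (fun i => errorTerm M B K (D i) (δ i) (d i)) l (𝓝 0) := by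
  simpa [errorTerm] using (ENNReal.Tendsto.const_mul (hD.max hδ) (.inr ENNReal.ofReal_ne_top)).add
    (ENNReal.Tendsto.const_mul hd (.inr ENNReal.ofReal_ne_top))

theorem ofReal_le_mul_errorTerm {e V : ℝ} {D δ d : ℝ≥0∞} (hM : 0 ≤ M) (hB : 0 ≤ B) (hK : 0 ≤ K)
    (hm : 0 < m) (he : 0 ≤ e) (hmax : max D δ = ENNReal.ofReal e)
    (h : ∀ d' : ℝ, 0 ≤ d' → d ≤ ENNReal.ofReal d' →
      m * V ≤ (3 * B + 1) * K * e + (2 * M + 1) * d') :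
    ENNReal.ofReal V ≤ ENNReal.ofReal (1 / m) * errorTerm M B K D δ d := by
  have hM' : 0 < 2 * M + 1 := by positivity
  rcases eq_or_ne d ∞ with rfl | hd
  · simp [errorTerm, ENNReal.mul_top, hM', hm]
  · obtain ⟨d', hd', rfl⟩ : ∃ d' : ℝ, 0 ≤ d' ∧ d = ENNReal.ofReal d' :=
      ⟨d.toReal, ENNReal.toReal_nonneg, (ENNReal.ofReal_toReal hd).symm⟩
    rw [errorTerm, hmax, ← ENNReal.ofReal_mul (by positivity), ← ENNReal.ofReal_mul hM'.le,
      ← ENNReal.ofReal_add (by positivity) (by positivity), ← ENNReal.ofReal_mul (by positivity),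
      one_div_mul_eq_div]
    exact ENNReal.ofReal_le_ofReal ((le_div_iff₀' hm).2 (h d' hd' le_rfl))

end ErrorTerm

section ErrorBounds

variable {T : ℕ} {M B C K e : ℝ} {G : NonatomicGame T} {F : FiniteGame T}
  {P : PlayerPartition F.n} {A A' : Set (Act T)} {D : ℝ≥0∞} {xs : I → Act T}
  {xh : Fin F.n → Act T}

/-- The two error bounds of the theorem for one finite game: under aggregative strong
monotonicity for the aggregate actions, under strong monotonicity for the profiles. -/
def ErrorBounds (M B K : ℝ) (D : ℝ≥0∞) (G : NonatomicGame T) (F : FiniteGame T)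
    (P : PlayerPartition F.n) (xs : I → Act T) (xh : Fin F.n → Act T) : Prop :=
  (∀ β > 0, G.AggStronglyMonotone M β → ‖(∑ i, xh i) - ∫ θ, xs θ‖ₑ ^ 2 ≤
    ENNReal.ofReal (1 / β) * errorTerm M B K D (actionGap G F P) (subgradGap M G F P)) ∧
  (∀ α > 0, G.StronglyMonotone M α → eLpNorm (P.lift xh - xs) 2 volume ^ 2 ≤
    ENNReal.ofReal (1 / α) * errorTerm M B K D (actionGap G F P) (subgradGap M G F P))

theorem NonatomicGame.RegularCosts.bound_nonneg_of_mem_H (hcost : G.RegularCosts M B)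
    {x g : I → Act T} (hx : x ∈ L2 (cube T M)) (hg : g ∈ G.H x) : 0 ≤ B :=
  (hcost.ae_norm_le_of_mem_H hx hg).exists.elim fun _ h => (norm_nonneg _).trans h

theorem exists_mem_H_integral_inner_le_of_equilibria (hact : G.RegularActions M)
    (hcost : G.RegularCosts M B) (hF : F.RegularActions) (hC : 0 ≤ C) (hCK : C ≤ K) (he : 0 ≤ e)
    (hgap : actionGap G F P ≤ ENNReal.ofReal e) (heC : e + C * e ≤ 1)
    (hxs : G.IsVWE A xs) (hxh : F.IsPseudoVNE A' xh)
    (hy : ∃ y ∈ G.constrProfiles A, ∀ᵐ θ, ‖y θ - P.lift xh θ‖ ≤ C * e)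
    (hz : ∃ z ∈ F.constrProfiles A',
      ∀ i, ‖z i - ∫ θ in P.cell i, xs θ‖ ≤ P.weight i * (C * e)) :
    ∃ g ∈ G.H xs, ∀ d : ℝ, 0 ≤ d → subgradGap M G F P ≤ ENNReal.ofReal d →
      ∃ h ∈ G.H (P.lift xh), ∫ θ, ⟪h θ - g θ, P.lift xh θ - xs θ⟫ ≤
        (3 * B + 1) * K * e + (2 * M + 1) * d := by
  obtain ⟨hxs, g, hg, hW⟩ := hxs
  obtain ⟨hxh, γ, hγ, hN⟩ := hxh
  obtain ⟨y, hy, hyc⟩ := hy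
  obtain ⟨z, hz, hzc⟩ := hz
  have hCe : 0 ≤ C * e := mul_nonneg hC he
  have hB : 0 ≤ B := hcost.bound_nonneg_of_mem_H (hact.profiles_subset_L2 hxs.1) hg
  refine ⟨g, hg, fun d hd hsub => ?_⟩
  obtain ⟨h, hh, hle⟩ := exists_mem_H_integral_inner_le hact hcost hF he (by linarith) hd hgap
    hsub hxs.1 hg hy.1 (hW y hy) hxh.1 hγ (hN z hz) hyc hzc
  refine ⟨h, hh, hle.trans ?_⟩
  calc B * (C * e) + (B + d) * (C * e) + d * (2 * M + e)
      = 2 * B * (C * e) + (2 * M + (e + C * e)) * d := by ring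
    _ ≤ (3 * B + 1) * (K * e) + (2 * M + 1) * d := by
        gcongr
        linarith
    _ = (3 * B + 1) * K * e + (2 * M + 1) * d := by ring

theorem errorBounds_of_equilibria (hact : G.RegularActions M) (hcost : G.RegularCosts M B)
    (hF : F.RegularActions) (hC : 0 ≤ C) (hCK : C ≤ K) (he : 0 ≤ e)
    (hmax : max D (actionGap G F P) = ENNReal.ofReal e) (heC : e + C * e ≤ 1)
    (hxs : G.IsVWE A xs) (hxh : F.IsPseudoVNE A' xh)
    (hy : ∃ y ∈ G.constrProfiles A, ∀ᵐ θ, ‖y θ - P.lift xh θ‖ ≤ C * e)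
    (hz : ∃ z ∈ F.constrProfiles A',
      ∀ i, ‖z i - ∫ θ in P.cell i, xs θ‖ ≤ P.weight i * (C * e)) :
    ErrorBounds M B K D G F P xs xh := by
  have hgap : actionGap G F P ≤ ENNReal.ofReal e := hmax ▸ le_max_right _ _
  have hxsL := hact.profiles_subset_L2 hxs.1.1
  have hψL := lift_mem_cube hact hF he (by linarith [mul_nonneg hC he]) hgap hxh.1.1
  obtain ⟨g, hg, hstable⟩ := exists_mem_H_integral_inner_le_of_equilibria hact hcost hF hC hCK he
    hgap heC hxs hxh hy hz
  have hbound : ∀ {m V : ℝ}, 0 < m →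
      (∀ h ∈ G.H (P.lift xh), m * V ≤ ∫ θ, ⟪h θ - g θ, P.lift xh θ - xs θ⟫) →
      ENNReal.ofReal V ≤
        ENNReal.ofReal (1 / m) * errorTerm M B K D (actionGap G F P) (subgradGap M G F P) :=
    fun hm hmono => ofReal_le_mul_errorTerm hact.bound_nonneg
      (hcost.bound_nonneg_of_mem_H hxsL hg) (hC.trans hCK) hm he hmax fun d hd hsub =>
        let ⟨h, hh, hle⟩ := hstable d hd hsub
        (hmono h hh).trans hle
  refine ⟨fun β hβ hmono => ?_, fun α hα hmono => ?_⟩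
  · rw [← ofReal_norm, ← ENNReal.ofReal_pow (norm_nonneg _), ← P.integral_lift]
    exact hbound hβ fun h hh => hmono _ hψL _ hxsL h hh g hg
  · rw [eLpNorm_two_sq_eq_ofReal_integral (hψL.1.sub hxsL.1)]
    exact hbound hα fun h hh => hmono _ hψL _ hxsL h hh g hg

end ErrorBounds

section ApproxConst

/-- The constant `C` for which, when `A - G.aggregates` contains the ball of radius `r` of its
span and the two games and constraint sets are `e`-close, every feasible profile of one game has
a feasible profile of the other within `C * e`. -/
noncomputable def approxConst (M r : ℝ) : ℝ := 1 + 8 * (M + 1) / r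

variable {M e r : ℝ}

theorem approxConst_nonneg (hM : 0 ≤ M) (hr : 0 < r) : 0 ≤ approxConst M r := by
  unfold approxConst
  positivity

theorem two_mul_le_half_of_approxConst_mul_le_one (hM : 0 ≤ M) (hr : 0 < r) (he : 0 ≤ e)
    (h : approxConst M r * e ≤ 1) : 2 * e ≤ r / 2 := by
  have hle : 8 * (M + 1) * e ≤ r := by
    rw [← div_le_one hr, mul_div_right_comm]
    exact (mul_le_mul_of_nonneg_right (le_add_of_nonneg_left zero_le_one) he).trans h
  linarith [mul_nonneg hM he]

theorem lift_radius_le_approxConst_mul (hM : 0 ≤ M) (hr : 0 < r) (he : 0 ≤ e) :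
    e + 2 * e / r * (2 * M) ≤ approxConst M r * e :=
  calc e + 2 * e / r * (2 * M) = (1 + 4 * M / r) * e := by ring
    _ ≤ approxConst M r * e := by
        unfold approxConst
        gcongr <;> linarith

theorem finite_radius_le_approxConst_mul (hM : 0 ≤ M) (hr : 0 < r) (he : 0 ≤ e) (he1 : e ≤ 1)
    (her : 2 * e ≤ r / 2) :
    e + 2 * e / (r - 2 * e) * (2 * (M + e)) ≤ approxConst M r * e :=
  calc e + 2 * e / (r - 2 * e) * (2 * (M + e)) ≤ e + 2 * e / (r / 2) * (2 * (M + 1)) := by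
        gcongr
        linarith
    _ = approxConst M r * e := by
        unfold approxConst
        ring

end ApproxConst

section Convergence

variable {T : ℕ} {M B K ρ : ℝ} {G : NonatomicGame T} {F : ℕ → FiniteGame T}
  {P : ∀ ν, PlayerPartition (F ν).n} {e D : ℕ → ℝ≥0∞} {xs : I → Act T}
  {xh : ∀ ν, Fin (F ν).n → Act T} {A : Set (Act T)} {A' : ℕ → Set (Act T)}

/-- The conclusions (1) and (2) of the theorem for the profiles `xh ν` and the limit profile `xs`:
convergence, and the error bounds for all `ν` with `2 * e ν < ρ`. -/
def ConvergesWithRate (M B K ρ : ℝ) (G : NonatomicGame T) (F : ℕ → FiniteGame T)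
    (P : ∀ ν, PlayerPartition (F ν).n) (e D : ℕ → ℝ≥0∞) (xs : I → Act T)
    (xh : ∀ ν, Fin (F ν).n → Act T) : Prop :=
  (∀ β > 0, G.AggStronglyMonotone M β →
    Tendsto (fun ν => ∑ i, xh ν i) atTop (𝓝 (∫ θ, xs θ)) ∧
    ∀ ν, 2 * e ν < ENNReal.ofReal ρ →
      ‖(∑ i, xh ν i) - ∫ θ, xs θ‖ₑ ^ 2 ≤ ENNReal.ofReal (1 / β) *
        errorTerm M B K (D ν) (actionGap G (F ν) (P ν)) (subgradGap M G (F ν) (P ν))) ∧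
  (∀ α > 0, G.StronglyMonotone M α →
    Tendsto (fun ν => eLpNorm ((P ν).lift (xh ν) - xs) 2 volume) atTop (𝓝 0) ∧
    ∀ ν, 2 * e ν < ENNReal.ofReal ρ →
      eLpNorm ((P ν).lift (xh ν) - xs) 2 volume ^ 2 ≤ ENNReal.ofReal (1 / α) *
        errorTerm M B K (D ν) (actionGap G (F ν) (P ν)) (subgradGap M G (F ν) (P ν)))

theorem convergesWithRate_of_errorBounds (hρ : 0 < ρ) (hAAS : IsPseudoAAS M G F P)
    (hD : Tendsto D atTop (𝓝 0)) (he : Tendsto e atTop (𝓝 0))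
    (hbounds : ∀ ν, 2 * e ν < ENNReal.ofReal ρ →
      ErrorBounds M B K (D ν) G (F ν) (P ν) xs (xh ν)) :
    ConvergesWithRate M B K ρ G F P e D xs xh := by
  have hsmall : ∀ᶠ ν in atTop, 2 * e ν < ENNReal.ofReal ρ := by
    have h2e := ENNReal.Tendsto.const_mul he (.inr (ENNReal.ofNat_ne_top (n := 2)))
    rw [mul_zero] at h2e
    exact h2e.eventually_lt_const (ENNReal.ofReal_pos.2 hρ)
  have herror : ∀ m : ℝ, Tendsto (fun ν => ENNReal.ofReal m * errorTerm M B K (D ν)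
      (actionGap G (F ν) (P ν)) (subgradGap M G (F ν) (P ν))) atTop (𝓝 0) := fun m => by
    simpa using ENNReal.Tendsto.const_mul (tendsto_errorTerm_zero hD hAAS.actionGap_tendsto
      hAAS.subgradGap_tendsto) (.inr ENNReal.ofReal_ne_top)
  refine ⟨fun β hβ hmono => ⟨?_, fun ν hν => (hbounds ν hν).1 β hβ hmono⟩,
    fun α hα hmono => ⟨?_, fun ν hν => (hbounds ν hν).2 α hα hmono⟩⟩
  · exact tendsto_iff_enorm_sub_tendsto_zero.2 <| tendsto_zero_of_pow_le two_ne_zero (herror _)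
      (hsmall.mono fun ν hν => (hbounds ν hν).1 β hβ hmono)
  · exact tendsto_zero_of_pow_le two_ne_zero (herror _)
      (hsmall.mono fun ν hν => (hbounds ν hν).2 α hα hmono)

theorem errorBounds_of_span_inter_closedBall_subset {F : FiniteGame T} {P : PlayerPartition F.n}
    {A' : Set (Act T)} {xh : Fin F.n → Act T} {e r : ℝ} (hact : G.RegularActions M)
    (hcost : G.RegularCosts M B) (hF : F.RegularActions) (hA : Convex ℝ A) (hAc : IsCompact A)
    (hA' : Convex ℝ A') (hAc' : IsCompact A') (hr : 0 < r)
    (hball : (Submodule.span ℝ (A - G.aggregates) : Set (Act T)) ∩ Metric.closedBall 0 r ⊆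
      A - G.aggregates)
    (hU : A' - F.aggregates ⊆ Submodule.span ℝ (A - G.aggregates))
    (hK : approxConst M r ≤ K) (he : 0 ≤ e) (heC : e + approxConst M r * e ≤ 1)
    (hmax : max (actionGap G F P) (Metric.hausdorffEDist A' A) = ENNReal.ofReal e)
    (hxs : G.IsVWE A xs) (hxh : F.IsPseudoVNE A' xh) :
    ErrorBounds M B K (Metric.hausdorffEDist A' A) G F P xs xh := by
  have hgap : actionGap G F P ≤ ENNReal.ofReal e := hmax ▸ le_max_left _ _
  have hD : Metric.hausdorffEDist A' A ≤ ENNReal.ofReal e := hmax ▸ le_max_right _ _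
  have hM : 0 ≤ M := hact.bound_nonneg
  have hC : 0 ≤ approxConst M r := approxConst_nonneg hM hr
  have her : 2 * e ≤ r / 2 :=
    two_mul_le_half_of_approxConst_mul_le_one hM hr he (by linarith)
  obtain ⟨y, hy, hyc⟩ := exists_constrProfile_near_lift hact hA hAc hr hball he hgap hD hxh.1
  obtain ⟨z, hz, hzc⟩ := exists_finite_constrProfile_near hact hF hA' hAc' hU hball he
    (by linarith) hgap hD hxs.1
  refine errorBounds_of_equilibria hact hcost hF hC hK he ((max_comm _ _).trans hmax) heC hxs hxh
    ⟨y, hy, hyc.mono fun θ hθ => hθ.trans (lift_radius_le_approxConst_mul hM hr he)⟩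
    ⟨z, hz, fun i => (hzc i).trans ?_⟩
  gcongr
  · exact (P.weight_pos i).le
  · exact finite_radius_le_approxConst_mul hM hr he (by linarith [mul_nonneg hC he]) her

theorem exists_convergesWithRate_constrained (hact : G.RegularActions M)
    (hcost : G.RegularCosts M B) (hI : G.UniformInterior) (hA : Convex ℝ A) (hAc : IsCompact A)
    (hri : (intrinsicInterior ℝ A ∩ intrinsicInterior ℝ G.aggregates).Nonempty) :
    ∃ ρ > 0, ∃ ρ' > 0, ∀ (F : ℕ → FiniteGame T) (P : ∀ ν, PlayerPartition (F ν).n)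
      (A' : ℕ → Set (Act T)), IsPseudoAAS M G F P → ConstraintsConverge A A' →
      ∀ (xs : I → Act T) (xh : ∀ ν, Fin (F ν).n → Act T),
      G.IsVWE A xs → (∀ ν, (F ν).IsPseudoVNE (A' ν) (xh ν)) →
      ConvergesWithRate M B ((M + 1) / min ρ ρ') ρ G F P
        (fun ν => max (actionGap G (F ν) (P ν)) (Metric.hausdorffEDist (A' ν) A))
        (fun ν => Metric.hausdorffEDist (A' ν) A) xs xh := by
  obtain ⟨r, hr, hball⟩ := exists_span_inter_closedBall_subset_sub hri
  have hM : 0 ≤ M := hact.bound_nonneg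
  have hC : 0 ≤ approxConst M r := approxConst_nonneg hM hr
  have hρ : 0 < 1 / (1 + approxConst M r) := by positivity
  have hK : approxConst M r ≤ (M + 1) / (1 / (1 + approxConst M r)) := by
    rw [div_div_eq_mul_div, div_one]
    linarith [mul_nonneg hM hC]
  have hAne : A.Nonempty := hri.mono fun _ h => intrinsicInterior_subset h.1
  refine ⟨_, hρ, _, hρ, fun F P A' hAAS hconv xs xh hxs hxh => ?_⟩
  rw [min_self]
  refine convergesWithRate_of_errorBounds hρ hAAS hconv.tendsto
    (by simpa using hAAS.actionGap_tendsto.max hconv.tendsto) fun ν hν => ?_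
  obtain ⟨e, he, hmax, heρ⟩ := exists_eq_ofReal_of_two_mul_lt hν
  rw [lt_div_iff₀ (by positivity)] at heρ
  exact errorBounds_of_span_inter_closedBall_subset hact hcost (hAAS.actions ν) hA hAc
    (hconv.convex ν) (hconv.compact ν) hr hball
    (sub_aggregates_subset_span hact hI hAne (hAAS.span_eq ν) (hconv.span_eq ν)) hK he
    (by linarith [mul_nonneg hC he]) hmax hxs (hxh ν)

theorem convergesWithRate_of_aggregates_subset (hact : G.RegularActions M)
    (hcost : G.RegularCosts M B) (hAAS : IsPseudoAAS M G F P) (hA : G.aggregates ⊆ A)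
    (hA' : ∀ ν, (F ν).aggregates ⊆ A' ν) (hxs : G.IsVWE A xs)
    (hxh : ∀ ν, (F ν).IsPseudoVNE (A' ν) (xh ν)) :
    ConvergesWithRate M B 1 1 G F P (fun ν => actionGap G (F ν) (P ν)) (fun _ => 0) xs xh := by
  refine convergesWithRate_of_errorBounds one_pos hAAS tendsto_const_nhds hAAS.actionGap_tendsto
    fun ν hν => ?_
  obtain ⟨e, he, hgap, he1⟩ := exists_eq_ofReal_of_two_mul_lt hν
  obtain ⟨y, hy, hyc⟩ := exists_profile_near_lift hact he hgap.le (hxh ν).1.1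
  obtain ⟨z, hz, hzc⟩ := exists_finite_profile_near (hAAS.actions ν) he hgap.le hxs.1.1
  exact errorBounds_of_equilibria hact hcost (hAAS.actions ν) zero_le_one le_rfl he
    (by simpa using hgap) (by linarith) hxs (hxh ν)
    ⟨y, ⟨hy, hA ⟨y, hy, rfl⟩⟩, by simpa using hyc⟩
    ⟨z, ⟨hz, hA' ν ⟨z, hz, rfl⟩⟩, by simpa using hzc⟩

end Convergence

end AggGame

theorem mainTheorem5_general {T : ℕ} {M B : ℝ} (G : AggGame.NonatomicGame T)
    (hact : G.RegularActions M) (hcost : G.RegularCosts M B) :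
    (G.UniformInterior →
      ∀ A : Set (AggGame.Act T), Convex ℝ A → IsCompact A →
      (intrinsicInterior ℝ A ∩ intrinsicInterior ℝ G.aggregates).Nonempty →
      ∃ ρ > 0, ∃ ρ' > 0,
        ∀ (F : ℕ → AggGame.FiniteGame T) (P : ∀ ν, AggGame.PlayerPartition (F ν).n)
          (A' : ℕ → Set (AggGame.Act T)),
        AggGame.IsPseudoAAS M G F P → AggGame.ConstraintsConverge A A' →
        ∀ (xs : I → AggGame.Act T) (xh : ∀ ν, Fin (F ν).n → AggGame.Act T),
        G.IsVWE A xs → (∀ ν, (F ν).IsPseudoVNE (A' ν) (xh ν)) →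
        AggGame.ConvergesWithRate M B ((M + 1) / min ρ ρ') ρ G F P
          (fun ν => max (AggGame.actionGap G (F ν) (P ν)) (Metric.hausdorffEDist (A' ν) A))
          (fun ν => Metric.hausdorffEDist (A' ν) A) xs xh) ∧
    ∃ ρ > 0,
      ∀ (F : ℕ → AggGame.FiniteGame T) (P : ∀ ν, AggGame.PlayerPartition (F ν).n)
        (A : Set (AggGame.Act T)) (A' : ℕ → Set (AggGame.Act T)),
      AggGame.IsPseudoAAS M G F P →
      G.aggregates ⊆ A → (∀ ν, (F ν).aggregates ⊆ A' ν) →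
      ∀ (xs : I → AggGame.Act T) (xh : ∀ ν, Fin (F ν).n → AggGame.Act T),
      G.IsVWE A xs → (∀ ν, (F ν).IsPseudoVNE (A' ν) (xh ν)) →
      AggGame.ConvergesWithRate M B 1 ρ G F P (fun ν => AggGame.actionGap G (F ν) (P ν))
        (fun _ => 0) xs xh :=
  ⟨fun hI _ hA hAc hri => AggGame.exists_convergesWithRate_constrained hact hcost hI hA hAc hri,
    1, one_pos, fun _ _ _ _ hAAS hA hA' _ _ hxs hxh =>
      AggGame.convergesWithRate_of_aggregates_subset hact hcost hAAS hA hA' hxs hxh⟩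

theorem mainTheorem5 {T : ℕ} {M B : ℝ} (hM : 0 < M) (hB : 0 < B)
    (G : AggGame.NonatomicGame T) (hact : G.RegularActions M) (hcost : G.RegularCosts M B)
    (htech : G.MeasurableReplySubgrad) (hlip : G.ContinuousInAggregate M) :
    -- with aggregative constraints
    (G.UniformInterior →
      ∀ A : Set (AggGame.Act T), Convex ℝ A → IsCompact A →
      (intrinsicInterior ℝ A ∩ intrinsicInterior ℝ G.aggregates).Nonempty →
      ∃ ρ > 0, ∃ ρ' > 0,
        ∀ (F : ℕ → AggGame.FiniteGame T) (P : ∀ ν, AggGame.PlayerPartition (F ν).n)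
          (A' : ℕ → Set (AggGame.Act T)),
        AggGame.IsPseudoAAS M G F P → AggGame.ConstraintsConverge A A' →
        ∀ (xs : I → AggGame.Act T) (xh : ∀ ν, Fin (F ν).n → AggGame.Act T),
        G.IsVWE A xs → (∀ ν, (F ν).IsPseudoVNE (A' ν) (xh ν)) →
        (∀ β > 0, G.AggStronglyMonotone M β →
          Tendsto (fun ν => ∑ i, xh ν i) atTop (𝓝 (∫ θ, xs θ)) ∧
          ∀ ν, 2 * max (AggGame.actionGap G (F ν) (P ν)) (Metric.hausdorffEDist (A' ν) A)
              < ENNReal.ofReal ρ →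
            ‖(∑ i, xh ν i) - ∫ θ, xs θ‖ₑ ^ 2 ≤
              ENNReal.ofReal (1 / β) *
                AggGame.errorTerm M B ((M + 1) / min ρ ρ')
                  (Metric.hausdorffEDist (A' ν) A) (AggGame.actionGap G (F ν) (P ν))
                  (AggGame.subgradGap M G (F ν) (P ν))) ∧
        (∀ α > 0, G.StronglyMonotone M α →
          Tendsto (fun ν => eLpNorm ((P ν).lift (xh ν) - xs) 2 volume) atTop (𝓝 0) ∧
          ∀ ν, 2 * max (AggGame.actionGap G (F ν) (P ν)) (Metric.hausdorffEDist (A' ν) A)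
              < ENNReal.ofReal ρ →
            eLpNorm ((P ν).lift (xh ν) - xs) 2 volume ^ 2 ≤
              ENNReal.ofReal (1 / α) *
                AggGame.errorTerm M B ((M + 1) / min ρ ρ')
                  (Metric.hausdorffEDist (A' ν) A) (AggGame.actionGap G (F ν) (P ν))
                  (AggGame.subgradGap M G (F ν) (P ν)))) ∧
    -- without aggregative constraints: `K_A` and `D` are replaced by `1` and `0`
    (∃ ρ > 0,
      ∀ (F : ℕ → AggGame.FiniteGame T) (P : ∀ ν, AggGame.PlayerPartition (F ν).n)
        (A : Set (AggGame.Act T)) (A' : ℕ → Set (AggGame.Act T)),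
      AggGame.IsPseudoAAS M G F P →
      G.aggregates ⊆ A → (∀ ν, (F ν).aggregates ⊆ A' ν) →
      ∀ (xs : I → AggGame.Act T) (xh : ∀ ν, Fin (F ν).n → AggGame.Act T),
      G.IsVWE A xs → (∀ ν, (F ν).IsPseudoVNE (A' ν) (xh ν)) →
      (∀ β > 0, G.AggStronglyMonotone M β →
        Tendsto (fun ν => ∑ i, xh ν i) atTop (𝓝 (∫ θ, xs θ)) ∧
        ∀ ν, 2 * AggGame.actionGap G (F ν) (P ν) < ENNReal.ofReal ρ →
          ‖(∑ i, xh ν i) - ∫ θ, xs θ‖ₑ ^ 2 ≤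
            ENNReal.ofReal (1 / β) *
              AggGame.errorTerm M B 1 0 (AggGame.actionGap G (F ν) (P ν))
                (AggGame.subgradGap M G (F ν) (P ν))) ∧
      (∀ α > 0, G.StronglyMonotone M α →
        Tendsto (fun ν => eLpNorm ((P ν).lift (xh ν) - xs) 2 volume) atTop (𝓝 0) ∧
        ∀ ν, 2 * AggGame.actionGap G (F ν) (P ν) < ENNReal.ofReal ρ →
          eLpNorm ((P ν).lift (xh ν) - xs) 2 volume ^ 2 ≤
            ENNReal.ofReal (1 / α) *
              AggGame.errorTerm M B 1 0 (AggGame.actionGap G (F ν) (P ν))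
                (AggGame.subgradGap M G (F ν) (P ν)))) :=
  mainTheorem5_general G hact hcost
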